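/- Let $n,m\ge 0$ be integers with $m\le 2n$. Let $V$ be a real vector space with basis $\theta_1,\dots,\theta_n$ and let $\xi_1,\dots,\xi_n$ be the dual basis of $V^*$. Consider the graded real vector space $$H'=H'_{n,m}=\bigoplus_{i=0}^{m}(H')^{-m+2i},\qquad (H')^{-m+2i}:=\Lambda^i(V)\otimes\Lambda^{m-i}(V^*),$$ all other graded pieces being zero. The symmetric group $S_n$ acts on it by permuting the indices of the $\theta_k$ and of the $\xi_k$. Let $(-,-):\Lambda(V)\times\Lambda(V^*)\to\mathbb R$ be the bilinear map with $(u_1\wedge\cdots\wedge u_i,\,v_1\wedge\cdots\wedge v_i)=\det(v_k(u_l))$ for $u_l\in V$, $v_k\in V^*$, and $(\Lambda^i(V),\Lambda^j(V^*))=0$ for $i\ne j$. Define a bilinear form on $H'$ by $$\langle u\otimes v,\;u'\otimes v'\rangle:=\varepsilon\,(u,v')\,(u',v),\qquad \varepsilon=\begin{cases}(-1)^{m(m-1)/2},&0\le m\le n,\\(-1)^{(2n-m)(2n-m-1)/2},&n<m\le 2n,\end{cases}$$ and a linear operator $L:=\sum_{k=1}^n e_{\theta_k}\otimes i_{\theta_k}$,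 where $e_{\theta_k}$ is left exterior multiplication by $\theta_k$ on $\Lambda(V)$, $i_{\theta_k}$ is the interior product with $\theta_k$ on $\Lambda(V^*)$ (the anti-derivation with $i_{\theta_k}\alpha=\alpha(\theta_k)$ for $\alpha\in V^*$), and $(e\otimes i)(u\otimes v)=e(u)\otimes i(v)$. Then: (a) (Poincaré duality) $\langle-,-\rangle:H'\times H'\to\mathbb R$ is an $S_n$-equivariant (that is, $S_n$-invariant), symmetric, graded ($\langle (H')^i,(H')^j\rangle=0$ for $i\neq -j$) and non-degenerate bilinear form. (b) (Hard Lefschetz) $L$ maps $(H')^i$ to $(H')^{i+2}$, is $S_n$-equivariant and satisfies $\langle La,b\rangle=\langle a,Lb\rangle$ for all $a,b\in H'$; and for all $i\ge 0$, $L^i:(H')^{-i}\to(H')^{i}$ is an isomorphism. (c) (Hodge–Riemann relations) Put $i_0:=\max(0,m-n)$. Then $-m+2i_0$ is the lowest degree in which $H'$ is non-zero, and for all integers $0\le i\le m/2$ the Lefschetz form $(a,b)_L^{-m+2i}=\langle a,L^{m-2i}b\rangle$ on $(H')^{-m+2i}$ is $S_n$-equivariant and is $(-1)^{i-i_0}$-definite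 on the primitive subspace $\ker(L^{m-2i+1})\cap (H')^{-m+2i}$; that is, $(-1)^{i-i_0}(a,a)_L^{-m+2i}>0$ for every non-zero $a$ in this subspace. -/

import Mathlib

open scoped TensorProduct

noncomputable section

/-! ### Graded real vector spaces with a pairing and a Lefschetz operator

A graded vector space is given by its homogeneous pieces `H d` (`d : ℤ`) inside a real vector
space `M`; the graded space itself is the subspace `⨆ d, H d`. -/

namespace KahlerPackage

variable {M : Type*} [AddCommGroup M] [Module ℝ M]

/-- `B` is a symmetric, graded (`⟨H^i, H^j⟩ = 0` unless `i = -j`) and non-degenerate bilinear form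
on the graded space `⨆ d, H d`. -/
structure IsPoincarePairing (H : ℤ → Submodule ℝ M) (B : LinearMap.BilinForm ℝ M) : Prop where
  symm : ∀ a ∈ ⨆ d, H d, ∀ b ∈ ⨆ d, H d, B a b = B b a
  graded : ∀ i j : ℤ, i ≠ -j → ∀ a ∈ H i, ∀ b ∈ H j, B a b = 0
  nondegenerate : (B.restrict (⨆ d, H d)).Nondegenerate

/-- `L` is a linear operator of degree two on `⨆ d, H d`, self-adjoint with respect to `B`. -/
structure IsLefschetzOperator (H : ℤ → Submodule ℝ M) (B : LinearMap.BilinForm ℝ M)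
    (L : M →ₗ[ℝ] M) : Prop where
  degree_two : ∀ d : ℤ, ∀ a ∈ H d, L a ∈ H (d + 2)
  adjoint : ∀ a ∈ ⨆ d, H d, ∀ b ∈ ⨆ d, H d, B (L a) b = B a (L b)

/-- Hard Lefschetz: `L ^ i` restricts to a (linear) bijection from `H^{-i}` onto `H^i`, for all
`i ≥ 0`. -/
def HardLefschetz (H : ℤ → Submodule ℝ M) (L : M →ₗ[ℝ] M) : Prop :=
  ∀ i : ℕ, Set.BijOn (L ^ i) (H (-(i : ℤ))) (H (i : ℤ))

/-- The Lefschetz form `(a, b) ↦ ⟨a, L^k b⟩` (to be used on `H^{-k}`). -/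
def lefschetzForm (B : LinearMap.BilinForm ℝ M) (L : M →ₗ[ℝ] M) (k : ℕ) :
    LinearMap.BilinForm ℝ M :=
  B.compl₂ (L ^ k)

/-- The primitive subspace `P_L^{-k} = ker (L^{k+1}) ∩ H^{-k}`. -/
def primitive (H : ℤ → Submodule ℝ M) (L : M →ₗ[ℝ] M) (k : ℕ) : Submodule ℝ M :=
  LinearMap.ker (L ^ (k + 1)) ⊓ H (-(k : ℤ))

end KahlerPackage

/-! ### The space `⨁ᵢ Λⁱ(V) ⊗ Λ^{m-i}(V*)` -/

namespace ExteriorKahler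

/-- The representation of `Sₙ` on a vector space `W` permuting the vectors of the basis `b`:
`σ • b k = b (σ k)`. -/
def permRep {n : ℕ} {W : Type*} [AddCommGroup W] [Module ℝ W] (b : Module.Basis (Fin n) ℝ W) :
    Representation ℝ (Equiv.Perm (Fin n)) W where
  toFun σ := (b.equiv b σ).toLinearMap
  map_one' := b.ext fun k => by simp
  map_mul' σ τ := b.ext fun k => by simp

/-- The induced representation of `Sₙ` on the exterior algebra of `W`. -/
def extRep {n : ℕ} {W : Type*} [AddCommGroup W] [Module ℝ W] (b : Module.Basis (Fin n) ℝ W) :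
    Representation ℝ (Equiv.Perm (Fin n)) (ExteriorAlgebra ℝ W) where
  toFun σ := (ExteriorAlgebra.map (permRep b σ)).toLinearMap
  map_one' := by
    rw [map_one, Module.End.one_eq_id, ExteriorAlgebra.map_id]; rfl
  map_mul' σ τ := by
    rw [map_mul, Module.End.mul_eq_comp, ← ExteriorAlgebra.map_comp_map]; rfl

variable {V : Type*} [AddCommGroup V] [Module ℝ V]

variable (V) in
/-- `Λ(V) ⊗ Λ(V*)`, the ordinary tensor product of vector spaces (no Koszul signs). -/
abbrev Ambient : Type _ :=
  ExteriorAlgebra ℝ V ⊗[ℝ] ExteriorAlgebra ℝ (Module.Dual ℝ V)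

variable (V) in
/-- The subspace `Λⁱ(V) ⊗ Λʲ(V*)` of `Λ(V) ⊗ Λ(V*)`. -/
def bipiece (i j : ℕ) : Submodule ℝ (Ambient V) :=
  LinearMap.range (TensorProduct.mapIncl (⋀[ℝ]^i V) (⋀[ℝ]^j (Module.Dual ℝ V)))

variable (V) in
/-- The degree `d` piece of `H'_{n,m}`: it is `Λⁱ(V) ⊗ Λ^{m-i}(V*)` if `d = -m + 2i` with
`0 ≤ i ≤ m`, and zero if `d` is not of this form. -/
def piece (m : ℕ) (d : ℤ) : Submodule ℝ (Ambient V) :=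
  ⨆ (i : ℕ) (_ : i ≤ m ∧ d = -(m : ℤ) + 2 * (i : ℤ)), bipiece V i (m - i)

variable (V) in
/-- The total space `H'_{n,m}`. -/
def total (m : ℕ) : Submodule ℝ (Ambient V) := ⨆ d : ℤ, piece V m d

/-- The action of `Sₙ` on `Λ(V) ⊗ Λ(V*)`, permuting the basis `θ` of `V` and the dual basis `ξ`
of `V*`. -/
def rep {n : ℕ} (θ : Module.Basis (Fin n) ℝ V) :
    Representation ℝ (Equiv.Perm (Fin n)) (Ambient V) :=
  (extRep θ).tprod (extRep θ.dualBasis)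

variable (V) in
/-- The bilinear map `(-,-) : Λ(V) × Λ(V*) → ℝ`: on `Λⁱ(V) × Λⁱ(V*)` it is the determinant
pairing `(u₁ ∧ ⋯ ∧ uᵢ, v₁ ∧ ⋯ ∧ vᵢ) = det (v_k (u_l))`, and it vanishes on `Λⁱ(V) × Λʲ(V*)` for
`i ≠ j`. -/
def detPairing : ExteriorAlgebra ℝ V →ₗ[ℝ] ExteriorAlgebra ℝ (Module.Dual ℝ V) →ₗ[ℝ] ℝ :=
  LinearMap.flip <|
    (DirectSum.toModule ℝ ℕ (ExteriorAlgebra ℝ V →ₗ[ℝ] ℝ) fun i =>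
      (LinearMap.lcomp ℝ ℝ
        ((DirectSum.component ℝ ℕ (fun j => ⋀[ℝ]^j V) i).comp
          (DirectSum.decomposeLinearEquiv (fun j => ⋀[ℝ]^j V)).toLinearMap)).comp
        (exteriorPower.pairingDual ℝ V i)).comp
    (DirectSum.decomposeLinearEquiv (fun j => ⋀[ℝ]^j (Module.Dual ℝ V))).toLinearMap

/-- The global sign `ε`: `(-1)^{m(m-1)/2}` for `m ≤ n`, and `(-1)^{(2n-m)(2n-m-1)/2}` for
`n < m ≤ 2n`. The truncated subtractions agree with the true ones here: `k - 1` with `k = 0` is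
multiplied by `0`. -/
def sign (n m : ℕ) : ℝ :=
  if m ≤ n then (-1) ^ (m * (m - 1) / 2) else (-1) ^ ((2 * n - m) * (2 * n - m - 1) / 2)

variable (V) in
/-- The pairing `⟨u ⊗ v, u' ⊗ v'⟩ = ε (u, v') (u', v)`. -/
def pairing (n m : ℕ) : LinearMap.BilinForm ℝ (Ambient V) :=
  sign n m •
    ((TensorProduct.dualDistrib ℝ (ExteriorAlgebra ℝ V)
        (ExteriorAlgebra ℝ (Module.Dual ℝ V))).comp
      (TensorProduct.map (detPairing V).flip (detPairing V))).comp
    (TensorProduct.comm ℝ (ExteriorAlgebra ℝ V)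
      (ExteriorAlgebra ℝ (Module.Dual ℝ V))).toLinearMap

/-- The exterior product `e_w` with `w` on the left. -/
def extMul {W : Type*} [AddCommGroup W] [Module ℝ W] (w : W) :
    ExteriorAlgebra ℝ W →ₗ[ℝ] ExteriorAlgebra ℝ W :=
  LinearMap.mulLeft ℝ (ExteriorAlgebra.ι ℝ w)

/-- The interior product `i_v` with `v ∈ V` on `Λ(V*)`: the anti-derivation with
`i_v α = α v` for `α ∈ V*`. -/
def intMul (v : V) :
    ExteriorAlgebra ℝ (Module.Dual ℝ V) →ₗ[ℝ] ExteriorAlgebra ℝ (Module.Dual ℝ V) :=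
  CliffordAlgebra.contractLeft (Module.Dual.eval ℝ V v)

/-- `L = ∑ₖ e_{θₖ} ⊗ i_{θₖ}`. -/
def lefschetz {n : ℕ} (θ : Module.Basis (Fin n) ℝ V) : Ambient V →ₗ[ℝ] Ambient V :=
  ∑ k : Fin n, TensorProduct.map (extMul (θ k)) (intMul (θ k))

end ExteriorKahler

end

noncomputable section

namespace ExteriorKahler

open ExteriorAlgebra CliffordAlgebra

/-! ### Exterior and interior products, and the determinant pairing. -/

section Pairing

variable {V : Type*} [AddCommGroup V] [Module ℝ V]

/-! The proof compares powers of `L` with an explicit involution. Let `φ : Λ(V) ≃ Λ(V*)` be induced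
by `θ_k ↦ ξ_k`, and let `swap` send `u ⊗ v` to `φ⁻¹(v) ⊗ φ(u)`. The form `ε⟨a, swap b⟩` has the
tensor products of wedge monomials as an orthonormal basis, so it is positive definite
(`sign_mul_pairing_swap_pos`). Non-degeneracy of the pairing follows at once, since `swap` preserves
`H'`.

With `F = ∑ i_{ξ_k} ⊗ e_{ξ_k}`, the commutator `[L, F]` is multiplication by `d` in degree `d`
(`lefschetz_lowering_piece`). Thus `H'` is a finite-dimensional representation of `𝔰𝔩₂`, graded by
weight, and hard Lefschetz is a general fact about these (`SlTwo.hardLefschetz`).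

For the Hodge–Riemann relations, the Weyl group element `W = exp L · exp(-F) · exp L` is computed in
two ways. On a primitive vector of degree `-k`, `k! W a = L^k a` (`SlTwo.factorial_smul_weyl`). On
`Λⁱ ⊗ Λʲ`, `W` is `(-1)^(i + C(i+j, 2))` times `swap` (`weyl_eq_swap`): multiplication by `w` on the
left and by its dual covector on the right form a doublet, exchanged up to sign by `W`, and such
multiplications build every element from `1 ⊗ 1`. Hence on primitive vectors `⟨a, L^(m-2i) a⟩` is
`(m-2i)! (-1)^(i + C(m, 2)) ⟨a, swap a⟩`. Since `ε = (-1)^(C(m, 2) + i₀)` in both ranges of `m`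
(`sign_eq`), the resulting sign is `(-1)^(i - i₀)`. -/

lemma extMul_apply (w : V) (u : ExteriorAlgebra ℝ V) : extMul w u = ι ℝ w * u := rfl

lemma extMul_mem_exteriorPower (w : V) {i : ℕ} {u : ExteriorAlgebra ℝ V} (hu : u ∈ ⋀[ℝ]^i V) :
    extMul w u ∈ ⋀[ℝ]^(i + 1) V := by
  rw [extMul_apply, exteriorPower, pow_succ']
  exact Submodule.mul_mem_mul (LinearMap.mem_range_self _ w) hu

lemma contractLeft_extMul (d : Module.Dual ℝ V) (w : V) (u : ExteriorAlgebra ℝ V) :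
    contractLeft d (extMul w u) = d w • u - extMul w (contractLeft d u) :=
  contractLeft_ι_mul _ _ _

lemma extMul_comm (v w : V) (u : ExteriorAlgebra ℝ V) :
    extMul v (extMul w u) = - extMul w (extMul v u) := by
  simp only [extMul_apply, ← mul_assoc]
  rw [eq_neg_iff_add_eq_zero, ← add_mul, ι_add_mul_swap, zero_mul]

lemma extMul_extMul_self (v : V) (u : ExteriorAlgebra ℝ V) : extMul v (extMul v u) = 0 := by
  rw [extMul_apply, extMul_apply, ← mul_assoc, ι_sq_zero, zero_mul]

/-- Iterating the anti-derivation rule gives an alternating sum. It has the shape of a Laplace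
expansion, which is how adjointness for the determinant pairing is obtained in `detPairing_extMul`.
-/
lemma contractLeft_ιMulti (d : Module.Dual ℝ V) (n : ℕ) (v : Fin (n + 1) → V) :
    contractLeft d (ιMulti ℝ (n + 1) v) =
      ∑ k : Fin (n + 1), ((-1) ^ (k : ℕ) * d (v k)) • ιMulti ℝ n (v ∘ k.succAbove) := by
  induction n with
  | zero =>
    simp [ιMulti_succ_apply, Algebra.algebraMap_eq_smul_one]
  | succ n ih =>
    have := contractLeft_extMul d (v 0) (ιMulti ℝ (n + 1) (Matrix.vecTail v))
    rw [ιMulti_succ_apply]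
    rw [extMul_apply, ih, extMul_apply, Finset.mul_sum] at this
    rw [this, Fin.sum_univ_succ (n := n + 1), sub_eq_add_neg, ← Finset.sum_neg_distrib]
    congr 1
    · simp; rfl
    · refine Finset.sum_congr rfl fun k _ => ?_
      rw [ιMulti_succ_apply, mul_smul_comm, ← neg_smul]
      congr 1
      · simp [Matrix.vecTail, pow_succ]
      · congr 2
        ext x
        simp [Matrix.vecTail]

lemma contractLeft_mem_exteriorPower (d : Module.Dual ℝ V) {n : ℕ} {u : ExteriorAlgebra ℝ V}
    (hu : u ∈ ⋀[ℝ]^(n + 1) V) : contractLeft d u ∈ ⋀[ℝ]^n V := by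
  rw [← ιMulti_span_fixedDegree] at hu
  induction hu using Submodule.span_induction with
  | mem x hx =>
    obtain ⟨v, rfl⟩ := hx
    rw [contractLeft_ιMulti]
    exact Submodule.sum_mem _ fun k _ => Submodule.smul_mem _ _ (ιMulti_range ℝ n ⟨_, rfl⟩)
  | zero => simp
  | add x y _ _ hx hy => rw [map_add]; exact add_mem hx hy
  | smul c x _ hx => rw [map_smul]; exact Submodule.smul_mem _ _ hx

lemma contractLeft_eq_zero_of_mem_exteriorPower_zero (d : Module.Dual ℝ V)
    {u : ExteriorAlgebra ℝ V} (hu : u ∈ ⋀[ℝ]^0 V) : contractLeft d u = 0 := by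
  rw [← ιMulti_span_fixedDegree] at hu
  induction hu using Submodule.span_induction with
  | mem x hx => obtain ⟨v, rfl⟩ := hx; simp
  | zero => simp
  | add x y _ _ hx hy => rw [map_add, hx, hy, add_zero]
  | smul c x _ hx => rw [map_smul, hx, smul_zero]

lemma detPairing_coe {i j : ℕ} (u : ⋀[ℝ]^i V) (v : ⋀[ℝ]^j (Module.Dual ℝ V)) :
    detPairing V u v = exteriorPower.pairingDual ℝ V j v
      (DirectSum.decompose (fun j => ⋀[ℝ]^j V) (u : ExteriorAlgebra ℝ V) j) := by
  rw [detPairing]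
  simp only [LinearMap.flip_apply, LinearMap.comp_apply, LinearEquiv.coe_coe,
    DirectSum.decomposeLinearEquiv_apply, DirectSum.decompose_coe]
  rw [← DirectSum.lof_eq_of ℝ, DirectSum.toModule_lof]
  simp [DirectSum.component, DirectSum.lof_eq_of]
  rfl

lemma detPairing_ιMulti {i : ℕ} (u : Fin i → V) (v : Fin i → Module.Dual ℝ V) :
    detPairing V (ιMulti ℝ i u) (ιMulti ℝ i v) = Matrix.det (.of fun k l => v l (u k)) := by
  have := detPairing_coe (exteriorPower.ιMulti ℝ i u) (exteriorPower.ιMulti ℝ i v)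
  rw [DirectSum.decompose_coe, DirectSum.of_eq_same,
    exteriorPower.pairingDual_ιMulti_ιMulti] at this
  exact this

lemma detPairing_eq_zero {i j : ℕ} (h : i ≠ j) {u : ExteriorAlgebra ℝ V}
    {v : ExteriorAlgebra ℝ (Module.Dual ℝ V)} (hu : u ∈ ⋀[ℝ]^i V)
    (hv : v ∈ ⋀[ℝ]^j (Module.Dual ℝ V)) : detPairing V u v = 0 := by
  have := detPairing_coe ⟨u, hu⟩ ⟨v, hv⟩
  rw [DirectSum.decompose_coe, DirectSum.of_eq_of_ne _ _ _ h.symm, map_zero] at this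
  exact this

/-- Two bilinear maps out of exterior algebras agree if they agree on decomposable elements. -/
lemma bilin_ext {W X : Type*} [AddCommGroup W] [Module ℝ W] [AddCommGroup X] [Module ℝ X]
    {f g : ExteriorAlgebra ℝ V →ₗ[ℝ] ExteriorAlgebra ℝ W →ₗ[ℝ] X}
    (h : ∀ (i j : ℕ) (u : Fin i → V) (v : Fin j → W),
      f (ιMulti ℝ i u) (ιMulti ℝ j v) = g (ιMulti ℝ i u) (ιMulti ℝ j v)) : f = g := by
  refine LinearMap.ext_on (ιMulti_span ℝ V) ?_
  rintro _ ⟨⟨i, u⟩, rfl⟩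
  refine LinearMap.ext_on (ιMulti_span ℝ W) ?_
  rintro _ ⟨⟨j, v⟩, rfl⟩
  exact h i j u v

lemma ιMulti_mem {i : ℕ} (u : Fin i → V) : ιMulti ℝ i u ∈ ⋀[ℝ]^i V := ιMulti_range ℝ i ⟨u, rfl⟩

/-- Exterior multiplication by `w` and the interior product with `w` are adjoint. -/
lemma detPairing_extMul (w : V) (u : ExteriorAlgebra ℝ V)
    (v : ExteriorAlgebra ℝ (Module.Dual ℝ V)) :
    detPairing V (extMul w u) v = detPairing V u (intMul w v) := by
  suffices h : (detPairing V).comp (extMul w) = (detPairing V).compl₂ (intMul w) from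
    congrArg (fun f => f u v) h
  refine bilin_ext fun i j u v => ?_
  simp only [LinearMap.comp_apply, LinearMap.compl₂_apply]
  have hu := extMul_mem_exteriorPower w (ιMulti_mem u)
  rcases j with _ | j
  · rw [detPairing_eq_zero (Nat.succ_ne_zero i) hu (ιMulti_mem v), intMul,
      contractLeft_eq_zero_of_mem_exteriorPower_zero _ (ιMulti_mem v), map_zero]
  · by_cases hij : i = j
    · subst hij
      have h1 : extMul w (ιMulti ℝ i u) = ιMulti ℝ (i + 1) (Matrix.vecCons w u) := by
        rw [ιMulti_succ_apply]; simp [extMul_apply]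
      rw [h1, detPairing_ιMulti, intMul, contractLeft_ιMulti, map_sum, Matrix.det_succ_row_zero]
      refine Finset.sum_congr rfl fun k _ => ?_
      rw [map_smul, detPairing_ιMulti, smul_eq_mul]
      congr 1
    · rw [detPairing_eq_zero (by omega) hu (ιMulti_mem v),
        intMul, detPairing_eq_zero hij (ιMulti_mem u)
          (contractLeft_mem_exteriorPower _ (ιMulti_mem v))]

lemma detPairing_map_map {W : Type*} [AddCommGroup W] [Module ℝ W] (f : V →ₗ[ℝ] W)
    (g : Module.Dual ℝ V →ₗ[ℝ] Module.Dual ℝ W) (hfg : ∀ α v, g α (f v) = α v)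
    (u : ExteriorAlgebra ℝ V) (v : ExteriorAlgebra ℝ (Module.Dual ℝ V)) :
    detPairing W (ExteriorAlgebra.map f u) (ExteriorAlgebra.map g v) = detPairing V u v := by
  suffices h : ((detPairing W).comp (ExteriorAlgebra.map f).toLinearMap).compl₂
      (ExteriorAlgebra.map g).toLinearMap = detPairing V from congrArg (fun f => f u v) h
  refine bilin_ext fun i j u v => ?_
  simp only [LinearMap.comp_apply, LinearMap.compl₂_apply, AlgHom.toLinearMap_apply,
    map_apply_ιMulti]
  by_cases hij : i = j
  · subst hij
    simp [detPairing_ιMulti, hfg]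
  · rw [detPairing_eq_zero hij (ιMulti_mem _) (ιMulti_mem _),
      detPairing_eq_zero hij (ιMulti_mem _) (ιMulti_mem _)]

lemma map_mem_exteriorPower {W : Type*} [AddCommGroup W] [Module ℝ W] (f : V →ₗ[ℝ] W) {i : ℕ}
    {u : ExteriorAlgebra ℝ V} (hu : u ∈ ⋀[ℝ]^i V) : ExteriorAlgebra.map f u ∈ ⋀[ℝ]^i W := by
  rw [← ιMulti_span_fixedDegree] at hu
  induction hu using Submodule.span_induction with
  | mem x hx => obtain ⟨v, rfl⟩ := hx; rw [map_apply_ιMulti]; exact ιMulti_mem _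
  | zero => simp
  | add x y _ _ hx hy => rw [map_add]; exact add_mem hx hy
  | smul c x _ hx => rw [map_smul]; exact Submodule.smul_mem _ _ hx

lemma map_extMul {W : Type*} [AddCommGroup W] [Module ℝ W] (f : V →ₗ[ℝ] W) (w : V)
    (u : ExteriorAlgebra ℝ V) :
    ExteriorAlgebra.map f (extMul w u) = extMul (f w) (ExteriorAlgebra.map f u) := by
  simp [extMul_apply]

lemma contractLeft_map {W : Type*} [AddCommGroup W] [Module ℝ W] (f : V →ₗ[ℝ] W)
    (d : Module.Dual ℝ W) (u : ExteriorAlgebra ℝ V) :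
    contractLeft d (ExteriorAlgebra.map f u) =
      ExteriorAlgebra.map f (contractLeft (d ∘ₗ f) u) := by
  induction u using CliffordAlgebra.left_induction with
  | algebraMap r => simp
  | add x y hx hy => simp only [map_add, hx, hy]
  | ι_mul x m hx =>
    have h1 := contractLeft_extMul d (f m) (ExteriorAlgebra.map f x)
    have h2 := contractLeft_extMul (d ∘ₗ f) m x
    rw [← map_extMul, hx, ← map_extMul] at h1
    rw [extMul_apply] at h1 h2
    rw [h1, h2]
    simp

end Pairing

end ExteriorKahler

end

noncomputable section

namespace ExteriorKahler

open ExteriorAlgebra CliffordAlgebra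

/-! ### The pairing, `L` and the group action on the tensor product. -/

section Ambient

variable {V : Type*} [AddCommGroup V] [Module ℝ V]

lemma pairing_tmul (n m : ℕ) (u u' : ExteriorAlgebra ℝ V)
    (v v' : ExteriorAlgebra ℝ (Module.Dual ℝ V)) :
    pairing V n m (u ⊗ₜ v) (u' ⊗ₜ v') =
      sign n m * (detPairing V u v' * detPairing V u' v) := by
  simp [pairing, mul_comm]

lemma sign_mul_self (n m : ℕ) : sign n m * sign n m = 1 := by
  unfold sign
  split_ifs <;> rw [← mul_pow] <;> simp

lemma pairing_symm (n m : ℕ) (a b : Ambient V) : pairing V n m a b = pairing V n m b a := by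
  induction a using TensorProduct.induction_on with
  | zero => simp
  | add x y hx hy => rw [map_add, LinearMap.add_apply, map_add, hx, hy]
  | tmul u v =>
    induction b using TensorProduct.induction_on with
    | zero => simp
    | add x y hx hy => rw [map_add, map_add, LinearMap.add_apply, hx, hy]
    | tmul u' v' => rw [pairing_tmul, pairing_tmul]; ring

lemma lefschetz_tmul {n : ℕ} (θ : Module.Basis (Fin n) ℝ V) (u : ExteriorAlgebra ℝ V)
    (v : ExteriorAlgebra ℝ (Module.Dual ℝ V)) :
    lefschetz θ (u ⊗ₜ v) = ∑ k, extMul (θ k) u ⊗ₜ[ℝ] intMul (θ k) v := by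
  simp [lefschetz]

lemma pairing_lefschetz {n : ℕ} (θ : Module.Basis (Fin n) ℝ V) (m : ℕ) (a b : Ambient V) :
    pairing V n m (lefschetz θ a) b = pairing V n m a (lefschetz θ b) := by
  induction a using TensorProduct.induction_on with
  | zero => simp
  | add x y hx hy => simp only [map_add, LinearMap.add_apply, hx, hy]
  | tmul u v =>
    induction b using TensorProduct.induction_on with
    | zero => simp
    | add x y hx hy => simp only [map_add, hx, hy]
    | tmul u' v' =>
      simp only [lefschetz_tmul, map_sum, LinearMap.sum_apply, pairing_tmul, detPairing_extMul]

/-! ### The action of the symmetric group -/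

lemma permRep_basis {n : ℕ} {W : Type*} [AddCommGroup W] [Module ℝ W]
    (b : Module.Basis (Fin n) ℝ W) (σ : Equiv.Perm (Fin n)) (k : Fin n) :
    permRep b σ (b k) = b (σ k) := by
  simp [permRep]

lemma rep_tmul {n : ℕ} (θ : Module.Basis (Fin n) ℝ V) (σ : Equiv.Perm (Fin n))
    (u : ExteriorAlgebra ℝ V) (v : ExteriorAlgebra ℝ (Module.Dual ℝ V)) :
    rep θ σ (u ⊗ₜ v) = ExteriorAlgebra.map (permRep θ σ) u ⊗ₜ[ℝ]
      ExteriorAlgebra.map (permRep θ.dualBasis σ) v := rfl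

lemma permRep_dualBasis_apply {n : ℕ} (θ : Module.Basis (Fin n) ℝ V) (σ : Equiv.Perm (Fin n))
    (α : Module.Dual ℝ V) (v : V) : permRep θ.dualBasis σ α (permRep θ σ v) = α v := by
  suffices h : (permRep θ.dualBasis σ).compl₂ (permRep θ σ) = LinearMap.id from
    congrArg (fun f => f α v) h
  refine θ.dualBasis.ext fun k => θ.ext fun l => ?_
  rw [LinearMap.compl₂_apply, permRep_basis, permRep_basis]
  simp [Finsupp.single_apply]

lemma pairing_rep {n : ℕ} (θ : Module.Basis (Fin n) ℝ V) (m : ℕ) (σ : Equiv.Perm (Fin n))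
    (a b : Ambient V) : pairing V n m (rep θ σ a) (rep θ σ b) = pairing V n m a b := by
  induction a using TensorProduct.induction_on with
  | zero => simp
  | add x y hx hy => simp only [map_add, LinearMap.add_apply, hx, hy]
  | tmul u v =>
    induction b using TensorProduct.induction_on with
    | zero => simp
    | add x y hx hy => simp only [map_add, hx, hy]
    | tmul u' v' =>
      simp only [rep_tmul, pairing_tmul,
        detPairing_map_map _ _ (permRep_dualBasis_apply θ σ)]

lemma intMul_map_permRep {n : ℕ} (θ : Module.Basis (Fin n) ℝ V) (σ : Equiv.Perm (Fin n))
    (k : Fin n) (v : ExteriorAlgebra ℝ (Module.Dual ℝ V)) :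
    intMul (θ (σ k)) (ExteriorAlgebra.map (permRep θ.dualBasis σ) v) =
      ExteriorAlgebra.map (permRep θ.dualBasis σ) (intMul (θ k) v) := by
  rw [intMul, contractLeft_map, intMul]
  congr 3
  ext α
  simp [← permRep_basis, permRep_dualBasis_apply]

lemma lefschetz_rep {n : ℕ} (θ : Module.Basis (Fin n) ℝ V) (σ : Equiv.Perm (Fin n))
    (a : Ambient V) : lefschetz θ (rep θ σ a) = rep θ σ (lefschetz θ a) := by
  induction a using TensorProduct.induction_on with
  | zero => simp
  | add x y hx hy => simp only [map_add, hx, hy]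
  | tmul u v =>
    rw [rep_tmul, lefschetz_tmul, lefschetz_tmul, map_sum, ← Equiv.sum_comp σ]
    refine Finset.sum_congr rfl fun k _ => ?_
    rw [rep_tmul, intMul_map_permRep, map_extMul, permRep_basis]

lemma lefschetz_pow_rep {n : ℕ} (θ : Module.Basis (Fin n) ℝ V) (σ : Equiv.Perm (Fin n)) (k : ℕ)
    (a : Ambient V) : (lefschetz θ ^ k) (rep θ σ a) = rep θ σ ((lefschetz θ ^ k) a) := by
  have h : Commute (lefschetz θ) (rep θ σ) := LinearMap.ext fun a => lefschetz_rep θ σ a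
  exact congrArg (fun f => f a) (h.pow_left k).eq

/-! ### Bihomogeneous pieces -/

lemma tmul_mem_bipiece {i j : ℕ} {u : ExteriorAlgebra ℝ V}
    {v : ExteriorAlgebra ℝ (Module.Dual ℝ V)} (hu : u ∈ ⋀[ℝ]^i V)
    (hv : v ∈ ⋀[ℝ]^j (Module.Dual ℝ V)) : u ⊗ₜ v ∈ bipiece V i j :=
  ⟨⟨u, hu⟩ ⊗ₜ ⟨v, hv⟩, rfl⟩

lemma bipiece_le {i j : ℕ} {S : Submodule ℝ (Ambient V)}
    (h : ∀ u ∈ ⋀[ℝ]^i V, ∀ v ∈ ⋀[ℝ]^j (Module.Dual ℝ V), u ⊗ₜ v ∈ S) : bipiece V i j ≤ S := by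
  rintro _ ⟨x, rfl⟩
  induction x with
  | zero => simp
  | add x y hx hy => rw [map_add]; exact add_mem hx hy
  | tmul u v => exact h u u.2 v v.2

lemma bipiece_le_span_ιMulti (i j : ℕ) :
    bipiece V i j ≤ Submodule.span ℝ (Set.range fun x : (Fin i → V) × (Fin j → Module.Dual ℝ V) =>
      ιMulti ℝ i x.1 ⊗ₜ[ℝ] ιMulti ℝ j x.2) := by
  refine bipiece_le fun u hu v hv => ?_
  rw [← ιMulti_span_fixedDegree] at hu hv
  have h := Submodule.apply_mem_map₂ (TensorProduct.mk ℝ (ExteriorAlgebra ℝ V)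
    (ExteriorAlgebra ℝ (Module.Dual ℝ V))) hu hv
  rw [Submodule.map₂_span_span] at h
  refine Submodule.span_mono ?_ h
  rintro _ ⟨_, ⟨u, rfl⟩, _, ⟨v, rfl⟩, rfl⟩
  exact ⟨⟨u, v⟩, rfl⟩

lemma lefschetz_mem_bipiece {n : ℕ} (θ : Module.Basis (Fin n) ℝ V) {i j : ℕ} {a : Ambient V}
    (ha : a ∈ bipiece V i (j + 1)) : lefschetz θ a ∈ bipiece V (i + 1) j := by
  refine (bipiece_le (S := (bipiece V (i + 1) j).comap (lefschetz θ)) fun u hu v hv => ?_) ha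
  rw [Submodule.mem_comap, lefschetz_tmul]
  exact Submodule.sum_mem _ fun k _ =>
    tmul_mem_bipiece (extMul_mem_exteriorPower _ hu) (contractLeft_mem_exteriorPower _ hv)

lemma lefschetz_eq_zero_of_mem_bipiece {n : ℕ} (θ : Module.Basis (Fin n) ℝ V) {i : ℕ}
    {a : Ambient V} (ha : a ∈ bipiece V i 0) : lefschetz θ a = 0 := by
  refine (bipiece_le (S := LinearMap.ker (lefschetz θ)) fun u hu v hv => ?_) ha
  rw [LinearMap.mem_ker, lefschetz_tmul]
  refine Finset.sum_eq_zero fun k _ => ?_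
  rw [intMul, contractLeft_eq_zero_of_mem_exteriorPower_zero _ hv, TensorProduct.tmul_zero]

lemma rep_mem_bipiece {n : ℕ} (θ : Module.Basis (Fin n) ℝ V) (σ : Equiv.Perm (Fin n)) {i j : ℕ}
    {a : Ambient V} (ha : a ∈ bipiece V i j) : rep θ σ a ∈ bipiece V i j := by
  refine (bipiece_le (S := (bipiece V i j).comap (rep θ σ)) fun u hu v hv => ?_) ha
  rw [Submodule.mem_comap, rep_tmul]
  exact tmul_mem_bipiece (map_mem_exteriorPower _ hu) (map_mem_exteriorPower _ hv)

lemma pairing_eq_zero_of_mem_bipiece (n m : ℕ) {i j i' j' : ℕ} (h : i ≠ j' ∨ i' ≠ j)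
    {a b : Ambient V} (ha : a ∈ bipiece V i j) (hb : b ∈ bipiece V i' j') :
    pairing V n m a b = 0 := by
  refine (bipiece_le (S := LinearMap.ker ((pairing V n m).flip b)) fun u hu v hv => ?_) ha
  change pairing V n m (u ⊗ₜ v) b = 0
  refine (bipiece_le (S := LinearMap.ker (pairing V n m (u ⊗ₜ v))) fun u' hu' v' hv' => ?_) hb
  rw [LinearMap.mem_ker, pairing_tmul]
  rcases h with h | h
  · rw [detPairing_eq_zero h hu hv']; simp
  · rw [detPairing_eq_zero h hu' hv]; simp

lemma piece_eq_bipiece {m i : ℕ} (hi : i ≤ m) {d : ℤ} (hd : d = -(m : ℤ) + 2 * i) :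
    piece V m d = bipiece V i (m - i) := by
  subst hd
  apply le_antisymm
  · refine iSup₂_le fun k hk => ?_
    obtain rfl : i = k := by omega
    exact le_rfl
  · exact le_iSup₂_of_le i ⟨hi, rfl⟩ le_rfl

lemma piece_eq_bot {m : ℕ} {d : ℤ} (hd : ¬ ∃ i : ℕ, i ≤ m ∧ d = -(m : ℤ) + 2 * i) :
    piece V m d = ⊥ := by
  rw [piece, eq_bot_iff]
  exact iSup₂_le fun k hk => (hd ⟨k, hk⟩).elim

/-! ### The positive definite form -/

/-- The identification of `V` with `V*` given by the dual bases. -/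
def dualEquiv {n : ℕ} (θ : Module.Basis (Fin n) ℝ V) : V ≃ₗ[ℝ] Module.Dual ℝ V :=
  θ.equiv θ.dualBasis (Equiv.refl _)

lemma dualEquiv_basis {n : ℕ} (θ : Module.Basis (Fin n) ℝ V) (k : Fin n) :
    dualEquiv θ (θ k) = θ.dualBasis k := by simp [dualEquiv]

/-- The map `Λ(V) ≃ Λ(V*)` induced by the identification of `V` with `V*`. -/
def extDualEquiv {n : ℕ} (θ : Module.Basis (Fin n) ℝ V) :
    ExteriorAlgebra ℝ V ≃ₗ[ℝ] ExteriorAlgebra ℝ (Module.Dual ℝ V) :=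
  LinearEquiv.ofLinearMap (ExteriorAlgebra.map (dualEquiv θ).toLinearMap).toLinearMap
    (ExteriorAlgebra.map (dualEquiv θ).symm.toLinearMap).toLinearMap
    (by rw [← AlgHom.comp_toLinearMap, ExteriorAlgebra.map_comp_map]; simp)
    (by rw [← AlgHom.comp_toLinearMap, ExteriorAlgebra.map_comp_map]; simp)

lemma extDualEquiv_apply {n : ℕ} (θ : Module.Basis (Fin n) ℝ V) (u : ExteriorAlgebra ℝ V) :
    extDualEquiv θ u = ExteriorAlgebra.map (dualEquiv θ).toLinearMap u := rfl

lemma extDualEquiv_symm_apply {n : ℕ} (θ : Module.Basis (Fin n) ℝ V)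
    (v : ExteriorAlgebra ℝ (Module.Dual ℝ V)) :
    (extDualEquiv θ).symm v = ExteriorAlgebra.map (dualEquiv θ).symm.toLinearMap v := rfl

/-- The involution `u ⊗ v ↦ φ⁻¹(v) ⊗ φ(u)` of `Λ(V) ⊗ Λ(V*)`, with `φ` the identification of
`Λ(V)` with `Λ(V*)`. -/
def swap {n : ℕ} (θ : Module.Basis (Fin n) ℝ V) : Ambient V →ₗ[ℝ] Ambient V :=
  TensorProduct.map (extDualEquiv θ).symm.toLinearMap (extDualEquiv θ).toLinearMap ∘ₗ
    (TensorProduct.comm ℝ _ _).toLinearMap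

lemma swap_tmul {n : ℕ} (θ : Module.Basis (Fin n) ℝ V) (u : ExteriorAlgebra ℝ V)
    (v : ExteriorAlgebra ℝ (Module.Dual ℝ V)) :
    swap θ (u ⊗ₜ v) = (extDualEquiv θ).symm v ⊗ₜ extDualEquiv θ u := rfl

lemma swap_mem_bipiece {n : ℕ} (θ : Module.Basis (Fin n) ℝ V) {i j : ℕ} {a : Ambient V}
    (ha : a ∈ bipiece V i j) : swap θ a ∈ bipiece V j i := by
  refine (bipiece_le (S := (bipiece V j i).comap (swap θ)) fun u hu v hv => ?_) ha
  exact tmul_mem_bipiece (map_mem_exteriorPower _ hv) (map_mem_exteriorPower _ hu)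

/-- Monomials of different degrees are orthogonal by definition. In equal degree the determinant is
the coordinate of one basis monomial of the exterior power along another. -/
lemma detPairing_basis {n : ℕ} (θ : Module.Basis (Fin n) ℝ V) (s t : Finset (Fin n)) :
    detPairing V (θ.ExteriorAlgebra s) (extDualEquiv θ (θ.ExteriorAlgebra t)) =
      if s = t then 1 else 0 := by
  rw [extDualEquiv_apply, ExteriorAlgebra.basis_apply, ExteriorAlgebra.basis_apply]
  by_cases h : s.card = t.card
  · obtain ⟨k, hk⟩ : ∃ k, k = s.card := ⟨_, rfl⟩
    rw [← ExteriorAlgebra.basis_apply, ← ExteriorAlgebra.basis_apply,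
      ExteriorAlgebra.basis_apply_ofCard θ hk.symm,
      ExteriorAlgebra.basis_apply_ofCard θ (h.symm.trans hk.symm), map_apply_ιMulti]
    have h1 := exteriorPower.basis_repr_apply ℝ k θ
      (exteriorPower.ιMulti_family ℝ k θ (Set.powersetCard.ofCard hk.symm))
      (Set.powersetCard.ofCard (h.symm.trans hk.symm))
    rw [exteriorPower.basis_repr, exteriorPower.ιMulti_family,
      exteriorPower.ιMultiDual_apply_ιMulti] at h1
    rw [detPairing_ιMulti]
    convert h1.symm using 1
    · congr 1
      ext x y
      simp [dualEquiv_basis]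
    · rw [Finsupp.single_apply]
      congr 1
      simp [Set.powersetCard.ofCard]
  · rw [if_neg (fun h' => h (congrArg _ h')), map_apply_ιMulti,
      detPairing_eq_zero h (ιMulti_mem _) (ιMulti_mem _)]

lemma bilin_self_pos {M ι : Type*} [AddCommGroup M] [Module ℝ M] [DecidableEq ι]
    (b : Module.Basis ι ℝ M) (B : LinearMap.BilinForm ℝ M)
    (h : ∀ i j, B (b i) (b j) = if i = j then 1 else 0) {a : M} (ha : a ≠ 0) : 0 < B a a := by
  have h1 : B a a = ∑ i ∈ (b.repr a).support, b.repr a i ^ 2 := by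
    conv_lhs => rw [← b.linearCombination_repr a]
    rw [Finsupp.linearCombination_apply, Finsupp.sum]
    simp only [map_sum, LinearMap.sum_apply, map_smul, LinearMap.smul_apply, h, smul_eq_mul]
    refine Finset.sum_congr rfl fun i hi => ?_
    rw [Finset.sum_eq_single i] <;> simp +contextual [sq, eq_comm]
  rw [h1]
  refine Finset.sum_pos (fun i hi => ?_) ?_
  · have := Finsupp.mem_support_iff.1 hi
    positivity
  · simpa using ha

/-- `⟨a, swap b⟩` is, up to the global sign, a scalar product. -/
lemma sign_mul_pairing_swap_pos {n : ℕ} (θ : Module.Basis (Fin n) ℝ V) (m : ℕ) {a : Ambient V}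
    (ha : a ≠ 0) : 0 < sign n m * pairing V n m a (swap θ a) := by
  refine bilin_self_pos (θ.ExteriorAlgebra.tensorProduct (θ.ExteriorAlgebra.map (extDualEquiv θ)))
    (sign n m • (pairing V n m).compl₂ (swap θ)) ?_ ha
  rintro ⟨s, t⟩ ⟨s', t'⟩
  simp only [LinearMap.smul_apply, LinearMap.compl₂_apply, Module.Basis.tensorProduct_apply,
    Module.Basis.map_apply, swap_tmul, LinearEquiv.symm_apply_apply, pairing_tmul,
    detPairing_basis, smul_eq_mul]
  rw [← mul_assoc, sign_mul_self, one_mul]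
  by_cases h1 : s = s' <;> by_cases h2 : t = t' <;> simp [h1, h2, eq_comm]

end Ambient

end ExteriorKahler

end

noncomputable section

/-! ### Representations of `𝔰𝔩₂` -/

namespace SlTwo

/-! ### Weight vectors, injectivity and hard Lefschetz. -/

section Weights

variable {M : Type*} [AddCommGroup M] [Module ℝ M] {H : ℤ → Submodule ℝ M} {L F : M →ₗ[ℝ] M}

lemma raise_pow_mem (hL : ∀ d, ∀ a ∈ H d, L a ∈ H (d + 2)) {d : ℤ} {a : M} (ha : a ∈ H d)
    (j : ℕ) : (L ^ j) a ∈ H (d + 2 * j) := by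
  induction j with
  | zero => simpa using ha
  | succ j ih =>
    rw [pow_succ', Module.End.mul_apply]
    convert hL _ _ ih using 2
    push_cast; ring

/-- Moving `F` past the successive factors of `L^(j+1)` produces the weights `d, d + 2, …, d + 2j`,
whose sum is `(j + 1)(d + j)`. -/
lemma lower_raise_pow (hL : ∀ d, ∀ a ∈ H d, L a ∈ H (d + 2))
    (hc : ∀ d : ℤ, ∀ a ∈ H d, L (F a) - F (L a) = (d : ℝ) • a) {d : ℤ} {a : M} (ha : a ∈ H d)
    (j : ℕ) :
    F ((L ^ (j + 1)) a) =
      (L ^ (j + 1)) (F a) + (((j : ℝ) + 1) * (-(d : ℝ) - j)) • (L ^ j) a := by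
  induction j with
  | zero =>
    have := hc d a ha
    rw [sub_eq_iff_eq_add] at this
    simp [this]
  | succ j ih =>
    have h1 := hc _ _ (raise_pow_mem hL ha (j + 1))
    rw [sub_eq_iff_eq_add, ← sub_eq_iff_eq_add'] at h1
    rw [pow_succ', Module.End.mul_apply, ← h1, ih, map_add, map_smul, Module.End.mul_apply,
      ← Module.End.mul_apply L (L ^ j), ← pow_succ', add_sub_assoc, ← sub_smul]
    congr 2
    push_cast; ring

/-- Induction from the lowest weights upwards. At weight `-k` the coefficient in `lower_raise_pow`
vanishes for `j = k`, so `L^(k+1)` kills `F a`, and the induction hypothesis at weight `-(k+2)`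
gives `F a = 0`. -/
lemma eq_zero_of_raise_pow (hL : ∀ d, ∀ a ∈ H d, L a ∈ H (d + 2))
    (hF : ∀ d, ∀ a ∈ H d, F a ∈ H (d - 2))
    (hc : ∀ d : ℤ, ∀ a ∈ H d, L (F a) - F (L a) = (d : ℝ) • a)
    {N : ℕ} (hN : ∀ d : ℤ, d < -N → H d = ⊥) {k : ℕ} {a : M} (ha : a ∈ H (-(k : ℤ)))
    (h : (L ^ k) a = 0) : a = 0 := by
  obtain ⟨t, ht⟩ : ∃ t, N < k + t := ⟨N + 1, by omega⟩
  induction t generalizing k a with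
  | zero => rwa [hN _ (by omega), Submodule.mem_bot] at ha
  | succ t ih =>
    have hFa : F a = 0 := by
      have h1 := lower_raise_pow hL hc ha k
      rw [pow_succ', Module.End.mul_apply, h] at h1
      simp only [map_zero, Int.cast_neg, Int.cast_natCast, neg_neg, sub_self, mul_zero, zero_smul,
        add_zero] at h1
      refine ih (k := k + 2) (a := F a) ?_ ?_ (by omega)
      · convert hF _ _ ha using 2
        push_cast; ring
      · rw [pow_succ', pow_succ', Module.End.mul_apply, ← h1, map_zero]
    -- Once `F a = 0`, applying `F` to `L^(j+1) a = 0` leaves `(j + 1)(k - j) L^j a = 0` with a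
    -- non-zero coefficient for `j < k`, so the exponent descends to zero.
    suffices ∀ j ≤ k, (L ^ j) a = 0 → a = 0 from this k le_rfl h
    intro j
    induction j with
    | zero => simp
    | succ j ihj =>
      intro hj h0
      have h1 := lower_raise_pow hL hc ha j
      rw [h0, hFa, map_zero, map_zero, zero_add] at h1
      refine ihj (by omega) ((smul_eq_zero.1 h1.symm).resolve_left ?_)
      have h2 : (j : ℝ) + 1 ≤ k := by exact_mod_cast hj
      push_cast
      have h3 : (0 : ℝ) < j + 1 := by positivity
      exact mul_ne_zero h3.ne' (by linarith)

/-- Primitive vectors are lowest weight vectors: `L^(k+1) F a = F L^(k+1) a = 0`, and `L^(k+2)` is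
injective in weight `-(k+2)`. -/
lemma lower_eq_zero (hL : ∀ d, ∀ a ∈ H d, L a ∈ H (d + 2))
    (hF : ∀ d, ∀ a ∈ H d, F a ∈ H (d - 2))
    (hc : ∀ d : ℤ, ∀ a ∈ H d, L (F a) - F (L a) = (d : ℝ) • a)
    {N : ℕ} (hN : ∀ d : ℤ, d < -N → H d = ⊥) {k : ℕ} {a : M} (ha : a ∈ H (-(k : ℤ)))
    (h : (L ^ (k + 1)) a = 0) : F a = 0 := by
  have h1 := lower_raise_pow hL hc ha k
  rw [h] at h1
  simp only [map_zero, Int.cast_neg, Int.cast_natCast, neg_neg, sub_self, mul_zero, zero_smul,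
    add_zero] at h1
  refine eq_zero_of_raise_pow hL hF hc hN (k := k + 2) (a := F a) ?_ ?_
  · convert hF _ _ ha using 2
    push_cast; ring
  · rw [pow_succ', Module.End.mul_apply, ← h1, map_zero]

/-- Hard Lefschetz for finite-dimensional representations of `𝔰𝔩₂`. -/
lemma hardLefschetz (hL : ∀ d, ∀ a ∈ H d, L a ∈ H (d + 2))
    (hF : ∀ d, ∀ a ∈ H d, F a ∈ H (d - 2))
    (hc : ∀ d : ℤ, ∀ a ∈ H d, L (F a) - F (L a) = (d : ℝ) • a)
    {N : ℕ} (hN : ∀ d : ℤ, d < -N → H d = ⊥) (hN' : ∀ d : ℤ, (N : ℤ) < d → H d = ⊥)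
    (hfin : ∀ d, FiniteDimensional ℝ (H d)) : KahlerPackage.HardLefschetz H L := by
  intro k
  have hL' : ∀ a ∈ H (-(k : ℤ)), (L ^ k) a ∈ H k := fun a ha => by
    convert raise_pow_mem hL ha k using 2; ring
  -- Reversing the grading exchanges the roles of `L` and `F`, so `F^k` is injective in the opposite
  -- direction. The two dimensions then agree, and injectivity of `L^k` gives surjectivity.
  let H' : ℤ → Submodule ℝ M := fun d => H (-d)
  have hFH : ∀ d, ∀ a ∈ H' d, F a ∈ H' (d + 2) := fun d a ha => by
    convert hF _ a ha using 2; ring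
  have hLH : ∀ d, ∀ a ∈ H' d, L a ∈ H' (d - 2) := fun d a ha => by
    convert hL _ a ha using 2; ring
  have hF' : ∀ a ∈ H k, (F ^ k) a ∈ H (-(k : ℤ)) := fun a ha => by
    have : a ∈ H' (-(k : ℤ)) := by simpa [H'] using ha
    convert raise_pow_mem hFH this k using 2; ring
  have hinjL : Function.Injective ((L ^ k).restrict hL') := by
    rw [injective_iff_map_eq_zero]
    intro a h
    exact Subtype.ext (eq_zero_of_raise_pow hL hF hc hN a.2 (congrArg Subtype.val h))
  have hinjF : Function.Injective ((F ^ k).restrict hF') := by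
    rw [injective_iff_map_eq_zero]
    intro a h
    refine Subtype.ext (eq_zero_of_raise_pow (H := H') (N := N) (k := k) hFH hLH (fun d a ha => ?_)
      (fun d hd => hN' _ (by omega)) (by simp [H']) (congrArg Subtype.val h))
    rw [← neg_sub, hc _ a ha]
    simp
  have heq := le_antisymm (LinearMap.finrank_le_finrank_of_injective hinjL)
    (LinearMap.finrank_le_finrank_of_injective hinjF)
  have hsurj := (LinearMap.injective_iff_surjective_of_finrank_eq_finrank heq).1 hinjL
  refine ⟨hL', fun a ha b hb h => ?_, fun b hb => ?_⟩
  · exact congrArg Subtype.val (@hinjL ⟨a, ha⟩ ⟨b, hb⟩ (Subtype.ext h))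
  · obtain ⟨a, ha⟩ := hsurj ⟨b, hb⟩
    exact ⟨a, a.2, congrArg Subtype.val ha⟩

end Weights

open IsNilpotent Finset

/-! ### The Weyl group element on a primitive string. -/

section Weyl

variable {M : Type*} [AddCommGroup M] [Module ℝ M] {L F : M →ₗ[ℝ] M}

lemma lower_pow_raise_pow {k : ℕ} {a : M}
    (hFL : ∀ j < k, F ((L ^ (j + 1)) a) = ((j + 1) * (k - j)) • (L ^ j) a) {r : ℕ} (hr : r ≤ k) :
    (F ^ r) ((L ^ k) a) = (k.descFactorial r * r.factorial) • (L ^ (k - r)) a := by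
  induction r with
  | zero => simp
  | succ r ih =>
    obtain ⟨j, rfl⟩ : ∃ j, k = j + 1 + r := ⟨k - 1 - r, by omega⟩
    have h1 := hFL j (by omega)
    rw [pow_succ', Module.End.mul_apply, ih (by omega), map_nsmul, Nat.add_sub_cancel, h1,
      smul_smul, Nat.descFactorial_succ, Nat.factorial_succ]
    have e1 : j + 1 + r - r = j + 1 := by omega
    have e2 : j + 1 + r - j = r + 1 := by omega
    have e3 : j + 1 + r - (r + 1) = j := by omega
    rw [e1, e2, e3]
    congr 1
    ring

variable [Module ℚ M]

lemma factorial_smul_exp {k : ℕ} {a : M} (hL : IsNilpotent L) (hF : IsNilpotent F)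
    (hFa : F a = 0) (hLa : (L ^ (k + 1)) a = 0)
    (hFL : ∀ j < k, F ((L ^ (j + 1)) a) = ((j + 1) * (k - j)) • (L ^ j) a) :
    k.factorial • exp L a = exp F ((L ^ k) a) := by
  have hF0 : (F ^ (k + 1)) ((L ^ k) a) = 0 := by
    rw [pow_succ', Module.End.mul_apply, lower_pow_raise_pow hFL le_rfl, map_nsmul]
    simp [hFa]
  have h1 := exp_smul_eq_sum (m := a) hLa hL
  have h2 := exp_smul_eq_sum (m := (L ^ k) a) hF0 hF
  simp only [Module.End.smul_def] at h1 h2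
  -- The term of index `k - r` on the left matches that of index `r` on the right: both are the
  -- falling factorial `k!/(k-r)!` times `L^(k-r) a`.
  rw [h1, h2, ← Finset.sum_range_reflect, smul_sum]
  refine sum_congr rfl fun r hr => ?_
  have hr' : r ≤ k := by have := mem_range.1 hr; omega
  rw [lower_pow_raise_pow hFL hr', Nat.add_sub_cancel, ← Nat.cast_smul_eq_nsmul ℚ,
    ← Nat.cast_smul_eq_nsmul ℚ, smul_smul, smul_smul]
  congr 1
  have h3 := Nat.factorial_mul_descFactorial hr'
  rw [← h3]
  push_cast
  field_simp

/-- The action of the Weyl group element on a primitive vector. -/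
lemma factorial_smul_weyl {k : ℕ} {a : M} (hL : IsNilpotent L) (hF : IsNilpotent F)
    (hFa : F a = 0) (hLa : (L ^ (k + 1)) a = 0)
    (hFL : ∀ j < k, F ((L ^ (j + 1)) a) = ((j + 1) * (k - j)) • (L ^ j) a) :
    k.factorial • (exp L * exp (-F) * exp L) a = (L ^ k) a := by
  -- The factor `exp(-F)` cancels the `exp F` just obtained, and the outer `exp L` fixes `L^k a`
  -- because `L` kills it.
  rw [Module.End.mul_apply, ← map_nsmul, factorial_smul_exp hL hF hFa hLa hFL,
    ← Module.End.mul_apply, mul_assoc, exp_neg_mul_exp_self hF, mul_one]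
  have h1 := exp_smul_eq_sum (k := 1) (m := (L ^ k) a)
    (by rwa [Module.End.smul_def, ← Module.End.mul_apply, pow_one, ← pow_succ']) hL
  simpa using h1

end Weyl

/-! ### Exponentials and anticommuting doublets. -/

section Commutation

variable {A : Type*} [Ring A]

lemma pow_succ_mul_of_anticommute {X P Q : A} (hP : X * P = -(P * X)) (hQ : X * Q = P - Q * X)
    (j : ℕ) :
    X ^ (j + 1) * Q = Q * (-X) ^ (j + 1) + (j + 1 : ℕ) • (P * (-X) ^ j) := by
  have hP' : ∀ i : ℕ, X * (P * (-X) ^ i) = P * (-X) ^ (i + 1) := fun i => by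
    rw [← mul_assoc, hP, pow_succ', ← mul_assoc]; simp
  induction j with
  | zero => simp [hQ]; abel
  | succ j ih =>
    rw [pow_succ', mul_assoc, ih, mul_add, ← mul_assoc, hQ, mul_smul_comm, hP', sub_mul,
      mul_assoc Q, succ_nsmul _ (j + 1), pow_succ' (-X) (j + 1), neg_mul, mul_neg]
    abel

variable [Module ℚ A]

lemma exp_mul_of_anticommute {X P Q : A} (hX : IsNilpotent X) (hP : X * P = -(P * X))
    (hQ : X * Q = P - Q * X) : exp X * Q = (Q + P) * exp (-X) := by
  obtain ⟨N, hN⟩ := hX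
  have h1 : X ^ (N + 1) = 0 := by rw [_root_.pow_succ, hN, zero_mul]
  have h2 : (-X) ^ N = 0 := by rw [neg_pow, hN, mul_zero]
  -- The `P`-terms lag the `Q`-terms by one index, so the two copies of `exp (-X)` are truncated at
  -- different lengths: `N + 1` beside `Q`, `N` beside `P`.
  have h3 : (-X) ^ (N + 1) = 0 := by rw [_root_.pow_succ, h2, zero_mul]
  rw [add_mul, exp_eq_sum h1]
  nth_rw 1 [exp_eq_sum h3]
  rw [exp_eq_sum h2, sum_range_succ', sum_range_succ' _ N, add_mul, mul_add, sum_mul, mul_sum,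
    mul_sum, add_right_comm, ← sum_add_distrib]
  congr 1
  · refine sum_congr rfl fun j _ => ?_
    rw [smul_mul_assoc, pow_succ_mul_of_anticommute hP hQ, smul_add, mul_smul_comm, mul_smul_comm,
      ← Nat.cast_smul_eq_nsmul ℚ, smul_smul]
    congr 2
    rw [Nat.factorial_succ]
    push_cast
    field_simp
  · simp

/-- The Weyl group element exchanges the two generators of a doublet, up to sign. -/
lemma weyl_mul {L F P Q : A} (hL : IsNilpotent L) (hF : IsNilpotent F) (hLP : L * P = -(P * L))
    (hLQ : L * Q = P - Q * L) (hFQ : F * Q = -(Q * F)) (hFP : F * P = Q - P * F) :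
    exp L * exp (-F) * exp L * Q = P * (exp (-L) * exp F * exp (-L)) ∧
      exp L * exp (-F) * exp L * P = -(Q * (exp (-L) * exp F * exp (-L))) := by
  have e1 : exp L * Q = (Q + P) * exp (-L) := exp_mul_of_anticommute hL hLP hLQ
  have e2 : exp L * P = P * exp (-L) := by
    simpa using exp_mul_of_anticommute (P := 0) hL (by simp) (by simpa using hLP)
  have e3 : exp (-F) * Q = Q * exp F := by
    simpa using exp_mul_of_anticommute (P := 0) hF.neg (by simp) (by simp [hFQ])
  have e4 : exp (-F) * P = (P - Q) * exp F := by
    have := exp_mul_of_anticommute (X := -F) (P := -Q) (Q := P) hF.neg (by simpa using hFQ)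
      (by rw [neg_mul, hFP]; simp; abel)
    simpa [sub_eq_add_neg] using this
  constructor
  · rw [mul_assoc, e1, ← mul_assoc, mul_assoc (exp L), mul_add, e3, e4, ← add_mul,
      add_sub_cancel, ← mul_assoc, e2]
    simp only [mul_assoc]
  · rw [mul_assoc, e2, ← mul_assoc, mul_assoc (exp L), e4, ← mul_assoc, mul_sub, e1, e2, ← sub_mul,
      sub_add_cancel_right]
    simp only [mul_assoc, neg_mul]

/-- The relations are preserved when `L`, `F`, `P` change sign and `Q` does not. -/
lemma weyl_neg_mul {L F P Q : A} (hL : IsNilpotent L) (hF : IsNilpotent F)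
    (hLP : L * P = -(P * L)) (hLQ : L * Q = P - Q * L) (hFQ : F * Q = -(Q * F))
    (hFP : F * P = Q - P * F) :
    exp (-L) * exp F * exp (-L) * Q = -(P * (exp L * exp (-F) * exp L)) ∧
      exp (-L) * exp F * exp (-L) * P = Q * (exp L * exp (-F) * exp L) := by
  have h := weyl_mul (P := -P) (Q := Q) hL.neg hF.neg (by simp [hLP])
    (by rw [neg_mul, hLQ, mul_neg]; abel) (by simp [hFQ]) (by simp [hFP])
  simpa only [neg_neg, neg_mul, mul_neg, neg_inj] using h

end Commutation

end SlTwo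

end

noncomputable section

namespace ExteriorKahler

open ExteriorAlgebra CliffordAlgebra

/-- Euler's formula for the number operator on an exterior power. -/
lemma sum_extMul_contractLeft {n : ℕ} {W : Type*} [AddCommGroup W] [Module ℝ W] {b : Fin n → W}
    {d : Fin n → Module.Dual ℝ W} (h : ∀ w, ∑ k, d k w • b k = w) {i : ℕ}
    {u : ExteriorAlgebra ℝ W} (hu : u ∈ ⋀[ℝ]^i W) :
    ∑ k, extMul (b k) (contractLeft (d k) u) = (i : ℝ) • u := by
  suffices h1 : ∀ u ∈ Set.range (ιMulti ℝ i (M := W)),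
      (∑ k, (extMul (b k)).comp (contractLeft (Q := (0 : QuadraticForm ℝ W)) (d k))) u =
        ((i : ℝ) • LinearMap.id (R := ℝ) (M := ExteriorAlgebra ℝ W)) u by
    rw [← ιMulti_span_fixedDegree] at hu
    simpa using LinearMap.eqOn_span h1 hu
  rintro _ ⟨v, rfl⟩
  clear hu
  simp only [LinearMap.sum_apply, LinearMap.comp_apply, LinearMap.smul_apply, LinearMap.id_apply]
  induction i with
  | zero => simp
  | succ i ih =>
    have h2 : ιMulti ℝ (i + 1) v = extMul (v 0) (ιMulti ℝ i (Matrix.vecTail v)) := by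
      rw [ιMulti_succ_apply, extMul_apply]
    have h3 : ∑ k, d k (v 0) • extMul (b k) (ιMulti ℝ i (Matrix.vecTail v)) =
        extMul (v 0) (ιMulti ℝ i (Matrix.vecTail v)) := by
      simp only [extMul_apply]
      conv_rhs => rw [← h (v 0)]
      simp [Finset.sum_mul]
    rw [h2]
    simp only [contractLeft_extMul, map_sub, map_smul, Finset.sum_sub_distrib,
      extMul_comm (b _) (v 0)]
    rw [h3, Finset.sum_neg_distrib, ← map_sum, ih, map_smul]
    push_cast
    module

/-! ### The `𝔰𝔩₂`-triple on the tensor product, and its Weyl group element. -/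

section Lowering

variable {V : Type*} [AddCommGroup V] [Module ℝ V] {n : ℕ} (θ : Module.Basis (Fin n) ℝ V)

/-- The lowering operator `∑ₖ i_{ξₖ} ⊗ e_{ξₖ}`. -/
def lowering : Ambient V →ₗ[ℝ] Ambient V :=
  ∑ k : Fin n, TensorProduct.map (contractLeft (θ.dualBasis k)) (extMul (θ.dualBasis k))

lemma lowering_tmul (u : ExteriorAlgebra ℝ V) (v : ExteriorAlgebra ℝ (Module.Dual ℝ V)) :
    lowering θ (u ⊗ₜ v) =
      ∑ k, contractLeft (θ.dualBasis k) u ⊗ₜ[ℝ] extMul (θ.dualBasis k) v := by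
  simp [lowering]

lemma lowering_mem_bipiece {i j : ℕ} {a : Ambient V}
    (ha : a ∈ bipiece V (i + 1) j) : lowering θ a ∈ bipiece V i (j + 1) := by
  refine (bipiece_le (S := (bipiece V i (j + 1)).comap (lowering θ)) fun u hu v hv => ?_) ha
  rw [Submodule.mem_comap, lowering_tmul]
  exact Submodule.sum_mem _ fun k _ =>
    tmul_mem_bipiece (contractLeft_mem_exteriorPower _ hu) (extMul_mem_exteriorPower _ hv)

lemma lowering_eq_zero_of_mem_bipiece {j : ℕ} {a : Ambient V} (ha : a ∈ bipiece V 0 j) :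
    lowering θ a = 0 := by
  refine (bipiece_le (S := LinearMap.ker (lowering θ)) fun u hu v hv => ?_) ha
  rw [LinearMap.mem_ker, lowering_tmul]
  refine Finset.sum_eq_zero fun k _ => ?_
  rw [contractLeft_eq_zero_of_mem_exteriorPower_zero _ hu, TensorProduct.zero_tmul]

lemma sum_dualBasis_smul (w : V) : ∑ k, θ.dualBasis k w • θ k = w := by
  simp

lemma sum_smul_dualBasis (α : Module.Dual ℝ V) :
    ∑ k, Module.Dual.eval ℝ V (θ k) α • θ.dualBasis k = α := by
  refine θ.ext fun l => ?_
  simp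

lemma dualBasis_apply_basis (k l : Fin n) : θ.dualBasis k (θ l) = if k = l then 1 else 0 := by
  simp [Finsupp.single_apply, eq_comm]

/-- For `k ≠ l` the operators anticommute in both tensor factors and the two signs cancel. For `k =
l`, writing `A` and `B` for `e ∘ i` on the two factors, the term is `A ⊗ (1 - B) - (1 - A) ⊗ B = A ⊗
1 - 1 ⊗ B`. -/
lemma lefschetz_lowering_tmul (u : ExteriorAlgebra ℝ V)
    (v : ExteriorAlgebra ℝ (Module.Dual ℝ V)) :
    lefschetz θ (lowering θ (u ⊗ₜ v)) - lowering θ (lefschetz θ (u ⊗ₜ v)) =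
      (∑ k, extMul (θ k) (contractLeft (θ.dualBasis k) u)) ⊗ₜ v -
        u ⊗ₜ ∑ k, extMul (θ.dualBasis k) (intMul (θ k) v) := by
  simp only [lowering_tmul, lefschetz_tmul, map_sum, TensorProduct.sum_tmul,
    TensorProduct.tmul_sum]
  rw [Finset.sum_comm, ← Finset.sum_sub_distrib, ← Finset.sum_sub_distrib]
  refine Finset.sum_congr rfl fun k _ => ?_
  rw [← Finset.sum_sub_distrib, Finset.sum_eq_single k]
  · have h1 := contractLeft_extMul (θ.dualBasis k) (θ k) u
    have h2 := contractLeft_extMul (Module.Dual.eval ℝ V (θ k)) (θ.dualBasis k) v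
    rw [Module.Dual.eval_apply] at h2
    rw [dualBasis_apply_basis, if_pos rfl, one_smul] at h1 h2
    rw [intMul, h1, h2]
    simp only [TensorProduct.tmul_sub, TensorProduct.sub_tmul]
    abel
  · intro l _ hl
    have h1 := contractLeft_extMul (θ.dualBasis l) (θ k) u
    have h2 := contractLeft_extMul (Module.Dual.eval ℝ V (θ k)) (θ.dualBasis l) v
    rw [Module.Dual.eval_apply] at h2
    rw [dualBasis_apply_basis, if_neg hl, zero_smul, zero_sub] at h1 h2
    rw [intMul, h1, h2]
    simp only [TensorProduct.tmul_neg, TensorProduct.neg_tmul, sub_self]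
  · simp

lemma lefschetz_lowering {i j : ℕ} {a : Ambient V} (ha : a ∈ bipiece V i j) :
    lefschetz θ (lowering θ a) - lowering θ (lefschetz θ a) = ((i : ℝ) - j) • a := by
  suffices h : bipiece V i j ≤ LinearMap.ker (lefschetz θ * lowering θ - lowering θ * lefschetz θ -
      ((i : ℝ) - j) • LinearMap.id) from sub_eq_zero.1 (h ha)
  refine bipiece_le fun u hu v hv => ?_
  refine sub_eq_zero.2 ((lefschetz_lowering_tmul θ u v).trans ?_)
  have h1 := sum_extMul_contractLeft (sum_dualBasis_smul θ) hu
  have h2 := sum_extMul_contractLeft (sum_smul_dualBasis θ) hv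
  rw [h1]
  erw [h2]
  rw [← TensorProduct.smul_tmul', TensorProduct.tmul_smul, ← sub_smul]
  rfl

/-- The summands square to zero, and they commute because each tensor factor contributes one sign.
-/
lemma isNilpotent_lefschetz : IsNilpotent (lefschetz θ) := by
  refine Commute.isNilpotent_sum (fun k _ => ⟨2, ?_⟩) fun k l _ _ => ?_
  · ext u v
    simp [pow_two, extMul_extMul_self]
  · refine TensorProduct.ext' fun u v => ?_
    simp only [Module.End.mul_apply, TensorProduct.map_tmul]
    rw [extMul_comm, intMul, intMul, contractLeft_comm, TensorProduct.neg_tmul,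
      TensorProduct.tmul_neg, neg_neg]

lemma isNilpotent_lowering : IsNilpotent (lowering θ) := by
  refine Commute.isNilpotent_sum (fun k _ => ⟨2, ?_⟩) fun k l _ _ => ?_
  · refine TensorProduct.ext' fun u v => ?_
    simp [pow_two, extMul_extMul_self]
  · refine TensorProduct.ext' fun u v => ?_
    simp only [Module.End.mul_apply, TensorProduct.map_tmul]
    rw [extMul_comm, contractLeft_comm, TensorProduct.neg_tmul, TensorProduct.tmul_neg, neg_neg]

variable (V) in
/-- Exterior multiplication by `w` on the left factor. -/
def mulLeft : V →ₗ[ℝ] Module.End ℝ (Ambient V) where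
  toFun w := TensorProduct.map (extMul w) LinearMap.id
  map_add' w w' :=
    TensorProduct.ext' fun u v => by simp [extMul_apply, add_mul, TensorProduct.add_tmul]
  map_smul' c w := TensorProduct.ext' fun u v => by simp [extMul_apply, TensorProduct.smul_tmul']

variable (V) in
/-- Exterior multiplication by `α` on the right factor. -/
def mulRight : Module.Dual ℝ V →ₗ[ℝ] Module.End ℝ (Ambient V) where
  toFun α := TensorProduct.map LinearMap.id (extMul α)
  map_add' w w' :=
    TensorProduct.ext' fun u v => by simp [extMul_apply, add_mul, TensorProduct.tmul_add]
  map_smul' c w := TensorProduct.ext' fun u v => by simp [extMul_apply]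

lemma mulLeft_tmul (w : V) (u : ExteriorAlgebra ℝ V) (v : ExteriorAlgebra ℝ (Module.Dual ℝ V)) :
    mulLeft V w (u ⊗ₜ v) = extMul w u ⊗ₜ v := rfl

lemma mulRight_tmul (α : Module.Dual ℝ V) (u : ExteriorAlgebra ℝ V)
    (v : ExteriorAlgebra ℝ (Module.Dual ℝ V)) : mulRight V α (u ⊗ₜ v) = u ⊗ₜ extMul α v := rfl

/-- This and the three relations below make `P = mulLeft w` and `Q = mulRight (dualEquiv w)` a
doublet as in `SlTwo.weyl_mul`. Anticommutators appear because, without Koszul signs, a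
multiplication on one factor meets only one half of each summand of `L` or `F`. -/
lemma lefschetz_mul_mulLeft (w : V) :
    lefschetz θ * mulLeft V w = -(mulLeft V w * lefschetz θ) := by
  refine TensorProduct.ext' fun u v => ?_
  simp only [Module.End.mul_apply, LinearMap.neg_apply, mulLeft_tmul, lefschetz_tmul, map_sum,
    ← Finset.sum_neg_distrib]
  refine Finset.sum_congr rfl fun k _ => ?_
  rw [extMul_comm, TensorProduct.neg_tmul]

lemma lowering_mul_mulRight (α : Module.Dual ℝ V) :
    lowering θ * mulRight V α = -(mulRight V α * lowering θ) := by
  refine TensorProduct.ext' fun u v => ?_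
  simp only [Module.End.mul_apply, LinearMap.neg_apply, mulRight_tmul, lowering_tmul, map_sum,
    ← Finset.sum_neg_distrib]
  refine Finset.sum_congr rfl fun k _ => ?_
  rw [extMul_comm, TensorProduct.tmul_neg]

lemma dualEquiv_apply_basis (w : V) (k : Fin n) : dualEquiv θ w (θ k) = θ.dualBasis k w := by
  suffices h : (dualEquiv θ).toLinearMap.flip (θ k) = θ.dualBasis k from congrArg (fun f => f w) h
  refine θ.ext fun l => ?_
  rw [LinearMap.flip_apply, LinearEquiv.coe_coe, dualEquiv_basis, dualBasis_apply_basis,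
    dualBasis_apply_basis]
  simp [eq_comm]

lemma lefschetz_mul_mulRight (w : V) :
    lefschetz θ * mulRight V (dualEquiv θ w) =
      mulLeft V w - mulRight V (dualEquiv θ w) * lefschetz θ := by
  have h0 : mulLeft V w = ∑ k, dualEquiv θ w (θ k) • mulLeft V (θ k) := by
    conv_lhs => rw [← sum_dualBasis_smul θ w]
    simp only [map_sum, map_smul, dualEquiv_apply_basis]
  rw [h0]
  refine TensorProduct.ext' fun u v => ?_
  simp only [Module.End.mul_apply, LinearMap.sub_apply, LinearMap.sum_apply, LinearMap.smul_apply,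
    mulRight_tmul, lefschetz_tmul, map_sum, mulLeft_tmul, ← Finset.sum_sub_distrib]
  refine Finset.sum_congr rfl fun k _ => ?_
  rw [intMul, contractLeft_extMul, TensorProduct.tmul_sub, TensorProduct.tmul_smul]
  rfl

lemma lowering_mul_mulLeft (w : V) :
    lowering θ * mulLeft V w =
      mulRight V (dualEquiv θ w) - mulLeft V w * lowering θ := by
  have h0 : mulRight V (dualEquiv θ w) = ∑ k, θ.dualBasis k w • mulRight V (θ.dualBasis k) := by
    conv_lhs => rw [← sum_dualBasis_smul θ w]
    simp only [map_sum, map_smul, dualEquiv_basis]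
  rw [h0]
  refine TensorProduct.ext' fun u v => ?_
  simp only [Module.End.mul_apply, LinearMap.sub_apply, LinearMap.sum_apply, LinearMap.smul_apply,
    mulRight_tmul, lowering_tmul, map_sum, mulLeft_tmul, ← Finset.sum_sub_distrib]
  refine Finset.sum_congr rfl fun k _ => ?_
  rw [contractLeft_extMul, TensorProduct.sub_tmul, TensorProduct.smul_tmul']

lemma swap_mulLeft (w : V) (a : Ambient V) :
    swap θ (mulLeft V w a) = mulRight V (dualEquiv θ w) (swap θ a) := by
  induction a using TensorProduct.induction_on with
  | zero => simp
  | add x y hx hy => simp only [map_add, hx, hy]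
  | tmul u v =>
    rw [mulLeft_tmul, swap_tmul, swap_tmul, mulRight_tmul, extDualEquiv_apply, map_extMul]
    rfl

lemma swap_mulRight (w : V) (a : Ambient V) :
    swap θ (mulRight V (dualEquiv θ w) a) = mulLeft V w (swap θ a) := by
  induction a using TensorProduct.induction_on with
  | zero => simp
  | add x y hx hy => simp only [map_add, hx, hy]
  | tmul u v =>
    rw [mulRight_tmul, swap_tmul, swap_tmul, mulLeft_tmul, extDualEquiv_symm_apply, map_extMul]
    simp [extDualEquiv_symm_apply]

open IsNilpotent

/-- The Weyl group element acts on a bihomogeneous piece by the involution `swap`, up to sign. -/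
lemma weyl_eq_swap [Module ℚ (Ambient V)] {i j : ℕ} {a : Ambient V} (ha : a ∈ bipiece V i j) :
    (exp (lefschetz θ) * exp (-lowering θ) * exp (lefschetz θ)) a =
      (-1 : ℝ) ^ (i + (i + j).choose 2) • swap θ a := by
  set W := exp (lefschetz θ) * exp (-lowering θ) * exp (lefschetz θ) with hW
  set W' := exp (-lefschetz θ) * exp (lowering θ) * exp (-lefschetz θ) with hW'
  have hN := isNilpotent_lefschetz θ
  have hN' := isNilpotent_lowering θ
  have key (w : V) := SlTwo.weyl_mul hN hN' (lefschetz_mul_mulLeft θ w)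
    (lefschetz_mul_mulRight θ w) (lowering_mul_mulRight θ _) (lowering_mul_mulLeft θ w)
  have key' (w : V) := SlTwo.weyl_neg_mul hN hN' (lefschetz_mul_mulLeft θ w)
    (lefschetz_mul_mulRight θ w) (lowering_mul_mulRight θ _) (lowering_mul_mulLeft θ w)
  simp only [← hW, ← hW'] at key key'
  have c1 (w : V) (x : Ambient V) : W (mulRight V (dualEquiv θ w) x) = mulLeft V w (W' x) :=
    congrArg (fun f => f x) (key w).1
  have c2 (w : V) (x : Ambient V) : W (mulLeft V w x) = -mulRight V (dualEquiv θ w) (W' x) :=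
    congrArg (fun f => f x) (key w).2
  have c3 (w : V) (x : Ambient V) : W' (mulRight V (dualEquiv θ w) x) = -mulLeft V w (W x) :=
    congrArg (fun f => f x) (key' w).1
  have c4 (w : V) (x : Ambient V) : W' (mulLeft V w x) = mulRight V (dualEquiv θ w) (W x) :=
    congrArg (fun f => f x) (key' w).2
  have hL1 : lefschetz θ ((1 : ExteriorAlgebra ℝ V) ⊗ₜ 1) = 0 := by
    rw [lefschetz_tmul]; simp [intMul]
  have hF1 : lowering θ ((1 : ExteriorAlgebra ℝ V) ⊗ₜ 1) = 0 := by
    rw [lowering_tmul]; simp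
  have hexp (X : Module.End ℝ (Ambient V)) (hX : IsNilpotent X) (x : Ambient V) (h : X x = 0) :
      exp X x = x := by
    have := exp_smul_eq_sum (k := 1) (m := x) (by simpa using h) hX
    simpa using this
  have hs1 : swap θ ((1 : ExteriorAlgebra ℝ V) ⊗ₜ 1) = 1 ⊗ₜ 1 := by
    rw [swap_tmul, extDualEquiv_symm_apply, extDualEquiv_apply, map_one, map_one]
  -- Moving a multiplication through `W` turns it into `W'` and conversely, so both formulas are
  -- needed in a single induction. It starts from `1 ⊗ 1`, which `L` and `F` kill.
  have main : ∀ (i j : ℕ) (u : Fin i → V) (v : Fin j → Module.Dual ℝ V),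
      W (ιMulti ℝ i u ⊗ₜ ιMulti ℝ j v) =
        (-1 : ℝ) ^ (i + (i + j).choose 2) • swap θ (ιMulti ℝ i u ⊗ₜ ιMulti ℝ j v) ∧
      W' (ιMulti ℝ i u ⊗ₜ ιMulti ℝ j v) =
        (-1 : ℝ) ^ (j + (i + j).choose 2) • swap θ (ιMulti ℝ i u ⊗ₜ ιMulti ℝ j v) := by
    have hch (m : ℕ) : (m + 1).choose 2 = m + m.choose 2 := by
      rw [Nat.choose_succ_succ' m 1, Nat.choose_one_right]
    intro i
    induction i with
    | zero =>
      intro j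
      induction j with
      | zero =>
        intro u v
        simp only [ιMulti_zero_apply, hs1, hW, hW', Module.End.mul_apply]
        have hL2 : (-lefschetz θ) ((1 : ExteriorAlgebra ℝ V) ⊗ₜ 1) = 0 := by
          rw [LinearMap.neg_apply, hL1, neg_zero]
        have hF2 : (-lowering θ) ((1 : ExteriorAlgebra ℝ V) ⊗ₜ 1) = 0 := by
          rw [LinearMap.neg_apply, hF1, neg_zero]
        rw [hexp _ hN _ hL1, hexp _ hN'.neg _ hF2, hexp _ hN _ hL1,
          hexp _ hN.neg _ hL2, hexp _ hN' _ hF1, hexp _ hN.neg _ hL2]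
        simp
      | succ j ih =>
        intro u v
        obtain ⟨w, hw⟩ := (dualEquiv θ).surjective (v 0)
        have h1 : ιMulti ℝ 0 u ⊗ₜ ιMulti ℝ (j + 1) v =
            mulRight V (dualEquiv θ w) (ιMulti ℝ 0 u ⊗ₜ ιMulti ℝ j (Matrix.vecTail v)) := by
          rw [ιMulti_succ_apply, mulRight_tmul, extMul_apply, hw]
        obtain ⟨ih1, ih2⟩ := ih u (Matrix.vecTail v)
        rw [h1, c1, c3, ih1, ih2, swap_mulRight, map_smul, map_smul, ← neg_smul]
        simp only [zero_add, hch]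
        refine ⟨trivial, ?_⟩
        congr 1
        rw [← add_assoc, show j + 1 + j = 2 * j + 1 by ring, pow_add, _root_.pow_succ, pow_mul]
        simp
    | succ i ih =>
      intro j u v
      have h1 : ιMulti ℝ (i + 1) u ⊗ₜ ιMulti ℝ j v =
          mulLeft V (u 0) (ιMulti ℝ i (Matrix.vecTail u) ⊗ₜ ιMulti ℝ j v) := by
        rw [ιMulti_succ_apply, mulLeft_tmul, extMul_apply]
      obtain ⟨ih1, ih2⟩ := ih j (Matrix.vecTail u) v
      rw [h1, c2, c4, ih1, ih2, swap_mulLeft, map_smul, map_smul, ← neg_smul]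
      rw [show i + 1 + j = i + j + 1 by ring, hch]
      constructor
      · congr 1
        rw [show i + 1 + (i + j + (i + j).choose 2) = 2 * i + 1 + (j + (i + j).choose 2) by ring,
          pow_add _ (2 * i + 1), _root_.pow_succ, pow_mul]
        simp
      · congr 1
        rw [show j + (i + j + (i + j).choose 2) = 2 * j + (i + (i + j).choose 2) by ring,
          pow_add _ (2 * j), pow_mul]
        simp
  have hle : bipiece V i j ≤ LinearMap.eqLocus W ((-1 : ℝ) ^ (i + (i + j).choose 2) • swap θ) := by
    refine (bipiece_le_span_ιMulti i j).trans (Submodule.span_le.2 ?_)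
    rintro _ ⟨⟨u, v⟩, rfl⟩
    exact (main i j u v).1
  exact hle ha

end Lowering

end ExteriorKahler

end

noncomputable section

namespace ExteriorKahler

open ExteriorAlgebra CliffordAlgebra

/-! ### Assembling the statements on the graded pieces. -/

section Pieces

variable {V : Type*} [AddCommGroup V] [Module ℝ V]

lemma mem_piece_cases {m : ℕ} {d : ℤ} {a : Ambient V} (ha : a ∈ piece V m d) :
    a = 0 ∨ ∃ i : ℕ, i ≤ m ∧ d = -(m : ℤ) + 2 * i ∧ a ∈ bipiece V i (m - i) := by
  by_cases hd : ∃ i : ℕ, i ≤ m ∧ d = -(m : ℤ) + 2 * i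
  · obtain ⟨i, hi, hd⟩ := hd
    exact Or.inr ⟨i, hi, hd, piece_eq_bipiece (V := V) hi hd ▸ ha⟩
  · rw [piece_eq_bot hd] at ha
    exact Or.inl ha

lemma mem_piece_of_mem_bipiece {i j : ℕ} {m : ℕ} {d : ℤ} (hij : i + j = m)
    (hd : d = -(m : ℤ) + 2 * i) {a : Ambient V} (ha : a ∈ bipiece V i j) : a ∈ piece V m d := by
  rw [piece_eq_bipiece (i := i) (by omega) hd]
  obtain rfl : j = m - i := by omega
  exact ha

variable {n : ℕ} (θ : Module.Basis (Fin n) ℝ V)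

lemma rep_mem_piece (σ : Equiv.Perm (Fin n)) {m : ℕ} {d : ℤ} {a : Ambient V}
    (ha : a ∈ piece V m d) : rep θ σ a ∈ piece V m d := by
  rcases mem_piece_cases ha with rfl | ⟨i, hi, hd, ha⟩
  · simp
  · exact mem_piece_of_mem_bipiece (by omega) hd (rep_mem_bipiece θ σ ha)

lemma lefschetz_mem_piece {m : ℕ} {d : ℤ} {a : Ambient V} (ha : a ∈ piece V m d) :
    lefschetz θ a ∈ piece V m (d + 2) := by
  rcases mem_piece_cases ha with rfl | ⟨i, hi, hd, ha⟩
  · simp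
  · obtain ⟨j, hj⟩ : ∃ j, m - i = j := ⟨_, rfl⟩
    rw [hj] at ha
    rcases j with _ | j
    · rw [lefschetz_eq_zero_of_mem_bipiece θ ha]; exact zero_mem _
    · exact mem_piece_of_mem_bipiece (by omega) (by push_cast; omega) (lefschetz_mem_bipiece θ ha)

lemma lowering_mem_piece {m : ℕ} {d : ℤ} {a : Ambient V} (ha : a ∈ piece V m d) :
    lowering θ a ∈ piece V m (d - 2) := by
  rcases mem_piece_cases ha with rfl | ⟨i, hi, hd, ha⟩
  · simp
  · rcases i with _ | i
    · rw [lowering_eq_zero_of_mem_bipiece θ ha]; exact zero_mem _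
    · exact mem_piece_of_mem_bipiece (by omega) (by push_cast at hd; omega)
        (lowering_mem_bipiece θ ha)

lemma swap_mem_piece {m : ℕ} {d : ℤ} {a : Ambient V} (ha : a ∈ piece V m d) :
    swap θ a ∈ piece V m (-d) := by
  rcases mem_piece_cases ha with rfl | ⟨i, hi, hd, ha⟩
  · simp
  · exact mem_piece_of_mem_bipiece (by omega) (by push_cast [Nat.cast_sub hi]; omega)
      (swap_mem_bipiece θ ha)

lemma swap_mem_total {m : ℕ} {a : Ambient V} (ha : a ∈ total V m) : swap θ a ∈ total V m := by
  have h : total V m ≤ (total V m).comap (swap θ) :=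
    iSup_le fun d a ha => Submodule.mem_iSup_of_mem (-d) (swap_mem_piece θ ha)
  exact h ha

lemma lefschetz_lowering_piece {m : ℕ} {d : ℤ} {a : Ambient V} (ha : a ∈ piece V m d) :
    lefschetz θ (lowering θ a) - lowering θ (lefschetz θ a) = (d : ℝ) • a := by
  rcases mem_piece_cases ha with rfl | ⟨i, hi, hd, ha⟩
  · simp
  · rw [lefschetz_lowering θ ha, hd]
    congr 1
    push_cast [Nat.cast_sub hi]
    ring

lemma piece_eq_bot_of_lt {m : ℕ} {d : ℤ} (hd : d < -(m : ℤ)) : piece V m d = ⊥ :=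
  piece_eq_bot fun ⟨i, _, h⟩ => by omega

lemma piece_eq_bot_of_gt {m : ℕ} {d : ℤ} (hd : (m : ℤ) < d) : piece V m d = ⊥ :=
  piece_eq_bot fun ⟨i, _, h⟩ => by omega

include θ in
lemma finiteDimensional_piece (m : ℕ) (d : ℤ) : FiniteDimensional ℝ (piece V m d) := by
  have : Module.Finite ℝ V := Module.Finite.of_basis θ
  by_cases hd : ∃ i : ℕ, i ≤ m ∧ d = -(m : ℤ) + 2 * i
  · obtain ⟨i, hi, hd⟩ := hd
    rw [piece_eq_bipiece hi hd, bipiece]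
    infer_instance
  · rw [piece_eq_bot hd]
    infer_instance

include θ in
lemma isPoincarePairing_piece (m : ℕ) :
    KahlerPackage.IsPoincarePairing (piece V m) (pairing V n m) where
  symm a _ b _ := pairing_symm n m a b
  graded i j hij a ha b hb := by
    rcases mem_piece_cases ha with rfl | ⟨k, hk, hd, ha⟩
    · simp
    rcases mem_piece_cases hb with rfl | ⟨l, hl, hd', hb⟩
    · simp
    exact pairing_eq_zero_of_mem_bipiece n m (by omega) ha hb
  nondegenerate := by
    have h : ∀ a ∈ total V m, (∀ b ∈ total V m, pairing V n m a b = 0) → a = 0 := by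
      intro a ha h
      by_contra h0
      have h1 := sign_mul_pairing_swap_pos θ m h0
      rw [h _ (swap_mem_total θ ha), mul_zero] at h1
      exact lt_irrefl _ h1
    refine ⟨fun a ha => Subtype.ext (h a a.2 fun b hb => ha ⟨b, hb⟩),
      fun a ha => Subtype.ext (h a a.2 fun b hb => ?_)⟩
    rw [pairing_symm]
    exact ha ⟨b, hb⟩

lemma hardLefschetz_piece (m : ℕ) : KahlerPackage.HardLefschetz (piece V m) (lefschetz θ) :=
  SlTwo.hardLefschetz (N := m) (fun _ _ ha => lefschetz_mem_piece θ ha)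
    (fun _ _ ha => lowering_mem_piece θ ha) (fun _ _ ha => lefschetz_lowering_piece θ ha)
    (fun _ hd => piece_eq_bot_of_lt hd) (fun _ hd => piece_eq_bot_of_gt hd)
    (finiteDimensional_piece θ m)

include θ in
lemma exteriorPower_ne_bot_iff (i : ℕ) : ⋀[ℝ]^i V ≠ ⊥ ↔ i ≤ n := by
  have : Module.Finite ℝ V := Module.Finite.of_basis θ
  have h1 := exteriorPower.finrank_eq ℝ i (M := V)
  rw [Module.finrank_eq_card_basis θ, Fintype.card_fin] at h1
  rw [ne_eq, ← Submodule.finrank_eq_zero, h1, Nat.choose_eq_zero_iff, not_lt]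

include θ in
-- Over a field, a tensor product of non-zero vectors is non-zero, as linear functionals on the two
-- factors detect.
lemma bipiece_ne_bot_iff (i j : ℕ) : bipiece V i j ≠ ⊥ ↔ i ≤ n ∧ j ≤ n := by
  rw [← exteriorPower_ne_bot_iff θ i, ← exteriorPower_ne_bot_iff θ.dualBasis j]
  constructor
  · refine fun h => ⟨fun h' => h ?_, fun h' => h ?_⟩ <;>
      refine eq_bot_iff.2 (bipiece_le fun u hu v hv => ?_)
    · rw [h', Submodule.mem_bot] at hu
      simp [hu]
    · rw [h', Submodule.mem_bot] at hv
      simp [hv]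
  · rintro ⟨h1, h2⟩ h
    obtain ⟨u, hu, hu0⟩ := Submodule.exists_mem_ne_zero_of_ne_bot h1
    obtain ⟨v, hv, hv0⟩ := Submodule.exists_mem_ne_zero_of_ne_bot h2
    have h3 := tmul_mem_bipiece hu hv
    rw [h, Submodule.mem_bot] at h3
    refine hu0 ((Module.forall_dual_apply_eq_zero_iff ℝ u).1 fun f => ?_)
    by_contra hf
    refine hv0 ((Module.forall_dual_apply_eq_zero_iff ℝ v).1 fun g => ?_)
    have h4 := TensorProduct.dualDistrib_apply f g u v
    rw [h3, map_zero] at h4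
    exact (mul_eq_zero.1 h4.symm).resolve_left hf

include θ in
lemma isLeast_piece_ne_bot {m : ℕ} (hm : m ≤ 2 * n) :
    IsLeast {d : ℤ | piece V m d ≠ ⊥} (-(m : ℤ) + 2 * max 0 ((m : ℤ) - n)) := by
  constructor
  -- The truncated `m - n` is `i₀`; the bound `i₀ ≤ n` is where `m ≤ 2n` enters.
  · rw [Set.mem_ofPred_eq, piece_eq_bipiece (i := m - n) (by omega) (by omega),
      bipiece_ne_bot_iff θ]
    omega
  · intro d hd
    by_cases h : ∃ i : ℕ, i ≤ m ∧ d = -(m : ℤ) + 2 * i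
    · obtain ⟨i, hi, h⟩ := h
      rw [Set.mem_ofPred_eq, piece_eq_bipiece hi h, bipiece_ne_bot_iff θ] at hd
      omega
    · exact (hd (piece_eq_bot h)).elim

/-- On primitive vectors, the power of the Lefschetz operator is a multiple of `swap`. -/
lemma lefschetz_pow_primitive {m i : ℕ} (hi : 2 * i ≤ m) {a : Ambient V}
    (ha : a ∈ KahlerPackage.primitive (piece V m) (lefschetz θ) (m - 2 * i)) :
    (lefschetz θ ^ (m - 2 * i)) a =
      ((m - 2 * i).factorial * (-1 : ℝ) ^ (i + m.choose 2)) • swap θ a := by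
  obtain ⟨hLa, ha⟩ := ha
  rw [SetLike.mem_coe, LinearMap.mem_ker] at hLa
  rw [SetLike.mem_coe] at ha
  -- The nilpotent exponential is taken over `ℚ`, so scalars are restricted.
  let _ : Module ℚ (Ambient V) := Module.compHom _ (algebraMap ℚ ℝ)
  have hFa : lowering θ a = 0 :=
    SlTwo.lower_eq_zero (N := m) (fun _ _ ha => lefschetz_mem_piece θ ha)
      (fun _ _ ha => lowering_mem_piece θ ha) (fun _ _ ha => lefschetz_lowering_piece θ ha)
      (fun _ hd => piece_eq_bot_of_lt hd) ha hLa
  have hFL : ∀ j < m - 2 * i, lowering θ ((lefschetz θ ^ (j + 1)) a) =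
      ((j + 1) * (m - 2 * i - j)) • (lefschetz θ ^ j) a := by
    intro j hj
    rw [SlTwo.lower_raise_pow (fun _ _ ha => lefschetz_mem_piece θ ha)
      (fun _ _ ha => lefschetz_lowering_piece θ ha) ha j, hFa, map_zero, zero_add,
      ← Nat.cast_smul_eq_nsmul ℝ]
    push_cast [Nat.cast_sub hj.le]
    rw [neg_neg]
  have h1 := SlTwo.factorial_smul_weyl (isNilpotent_lefschetz θ) (isNilpotent_lowering θ)
    hFa hLa hFL
  have h2 : a ∈ bipiece V i (m - i) := by
    rwa [piece_eq_bipiece (i := i) (by omega) (by omega)] at ha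
  rw [← h1, weyl_eq_swap θ h2, ← Nat.cast_smul_eq_nsmul ℝ, smul_smul,
    Nat.add_sub_cancel' (by omega)]

end Pieces

/-- Raising `m` by two adds the odd number `2m + 1` to `C(m, 2)`. -/
lemma neg_one_pow_choose_two_add (q p : ℕ) :
    (-1 : ℝ) ^ (q + 2 * p).choose 2 = (-1) ^ (q.choose 2 + p) := by
  induction p with
  | zero => simp
  | succ p ih =>
    have h (m : ℕ) : (m + 2).choose 2 = 2 * m + 1 + m.choose 2 := by
      rw [Nat.choose_succ_succ' (m + 1) 1, Nat.choose_one_right, Nat.choose_succ_succ' m 1,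
        Nat.choose_one_right]
      ring
    rw [show q + 2 * (p + 1) = q + 2 * p + 2 by ring, h, pow_add, ih, pow_succ, pow_mul,
      ← add_assoc, pow_succ]
    simp [pow_succ]

/-- For `m > n`, `m = (2n - m) + 2(m - n)`, so passing from `C(2n - m, 2)` to `C(m, 2)` costs the
sign `(-1)^(m - n)`; for `m ≤ n` the truncated difference is zero. -/
lemma sign_eq {n m : ℕ} (hm : m ≤ 2 * n) : sign n m = (-1) ^ (m.choose 2 + (m - n)) := by
  unfold sign
  split_ifs with h
  · rw [← Nat.choose_two_right, Nat.sub_eq_zero_of_le h, add_zero]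
  · have h1 := neg_one_pow_choose_two_add (2 * n - m) (m - n)
    rw [show 2 * n - m + 2 * (m - n) = m by omega] at h1
    rw [← Nat.choose_two_right, pow_add, h1, pow_add, mul_assoc, ← mul_pow]
    simp

lemma neg_one_zpow_sub {n m : ℕ} (i : ℕ) :
    (-1 : ℝ) ^ ((i : ℤ) - max 0 ((m : ℤ) - n)) = (-1) ^ (i + (m - n)) := by
  rw [show max 0 ((m : ℤ) - n) = ((m - n : ℕ) : ℤ) by omega, zpow_sub₀ (by norm_num),
    zpow_natCast, zpow_natCast, pow_add, div_eq_mul_inv, ← inv_pow]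
  norm_num

/-- The Hodge–Riemann relations. -/
lemma lefschetzForm_pos {V : Type*} [AddCommGroup V] [Module ℝ V] {n m : ℕ} (hm : m ≤ 2 * n)
    (θ : Module.Basis (Fin n) ℝ V) {i : ℕ} (hi : 2 * i ≤ m) {a : Ambient V}
    (ha : a ∈ KahlerPackage.primitive (piece V m) (lefschetz θ) (m - 2 * i)) (h0 : a ≠ 0) :
    0 < (-1 : ℝ) ^ ((i : ℤ) - max 0 ((m : ℤ) - n)) *
      KahlerPackage.lefschetzForm (pairing V n m) (lefschetz θ) (m - 2 * i) a a := by
  have h1 := sign_mul_pairing_swap_pos θ m h0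
  have h2 : (0 : ℝ) < (m - 2 * i).factorial := by positivity
  rw [KahlerPackage.lefschetzForm, LinearMap.compl₂_apply, lefschetz_pow_primitive θ hi ha,
    map_smul, smul_eq_mul, neg_one_zpow_sub]
  refine (mul_pos h2 h1).trans_eq ?_
  have h3 : (-1 : ℝ) ^ (i + (m - n)) * (-1) ^ (i + m.choose 2) = sign n m := by
    rw [sign_eq hm, ← pow_add, show i + (m - n) + (i + m.choose 2) =
      2 * i + (m.choose 2 + (m - n)) by ring, pow_add, pow_mul]
    simp
  rw [← h3]
  ring

end ExteriorKahler

end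

open KahlerPackage ExteriorKahler in
theorem theorem4p6 {V : Type*} [AddCommGroup V] [Module ℝ V] (n m : ℕ) (hm : m ≤ 2 * n)
    (θ : Module.Basis (Fin n) ℝ V) :
    -- the action of `Sₙ` preserves the grading
    (∀ (σ : Equiv.Perm (Fin n)) (d : ℤ), ∀ a ∈ piece V m d, rep θ σ a ∈ piece V m d) ∧
    -- (a) Poincaré duality
    (IsPoincarePairing (piece V m) (pairing V n m) ∧
      ∀ σ : Equiv.Perm (Fin n), ∀ a ∈ total V m, ∀ b ∈ total V m,
        pairing V n m (rep θ σ a) (rep θ σ b) = pairing V n m a b) ∧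
    -- (b) hard Lefschetz
    (IsLefschetzOperator (piece V m) (pairing V n m) (lefschetz θ) ∧
      (∀ σ : Equiv.Perm (Fin n), ∀ a ∈ total V m,
        lefschetz θ (rep θ σ a) = rep θ σ (lefschetz θ a)) ∧
      HardLefschetz (piece V m) (lefschetz θ)) ∧
    -- (c) Hodge–Riemann relations; the lowest non-zero degree is `-m + 2 i₀`, `i₀ = max(0, m - n)`
    (IsLeast {d : ℤ | piece V m d ≠ ⊥} (-(m : ℤ) + 2 * max 0 ((m : ℤ) - n)) ∧
      ∀ i : ℕ, 2 * i ≤ m →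
        (∀ σ : Equiv.Perm (Fin n),
          ∀ a ∈ piece V m (-(m : ℤ) + 2 * i), ∀ b ∈ piece V m (-(m : ℤ) + 2 * i),
            lefschetzForm (pairing V n m) (lefschetz θ) (m - 2 * i) (rep θ σ a) (rep θ σ b) =
              lefschetzForm (pairing V n m) (lefschetz θ) (m - 2 * i) a b) ∧
        (∀ a ∈ primitive (piece V m) (lefschetz θ) (m - 2 * i), a ≠ 0 →
          0 < (-1 : ℝ) ^ ((i : ℤ) - max 0 ((m : ℤ) - n)) *
            lefschetzForm (pairing V n m) (lefschetz θ) (m - 2 * i) a a)) := by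
  refine ⟨fun σ d a ha => rep_mem_piece θ σ ha,
    ⟨isPoincarePairing_piece θ m, fun σ a _ b _ => pairing_rep θ m σ a b⟩,
    ⟨⟨fun d a ha => lefschetz_mem_piece θ ha, fun a _ b _ => pairing_lefschetz θ m a b⟩,
      fun σ a _ => lefschetz_rep θ σ a, hardLefschetz_piece θ m⟩,
    isLeast_piece_ne_bot θ hm, fun i hi => ⟨fun σ a _ b _ => ?_,
      fun a ha h0 => lefschetzForm_pos hm θ hi ha h0⟩⟩
  rw [lefschetzForm, LinearMap.compl₂_apply, LinearMap.compl₂_apply, lefschetz_pow_rep, pairing_rep]
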